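/- All graphs are finite, and a bipartite graph $G$ carries a fixed bipartition $V(G)=L_G\sqcup R_G$ (two sorts); isomorphisms and automorphisms preserve both parts. The diamond product $G_1\diamond\dots\diamond G_k$ has vertex set $\prod_i L_{G_i}\sqcup\prod_i R_{G_i}$, and $(x_i)_i$, $(y_i)_i$ are adjacent if and only if $x_i$, $y_i$ are adjacent in $G_i$ for all $i$ (for $k=0$ it is a single edge). Write $G^\ell$ for the $\ell$-fold product $G\diamond\dots\diamond G$. $G$ is *prime* if whenever $G\cong A\diamond B$ with bipartite graphs $A,B$, one of $A,B$ is a single edge. On $V(G)$ let $x\,R\,x'$ mean that $x,x'$ lie in the same part and have the same neighbours; $[x]$ is the class of $x$, and $G/R$ is the graph on the classes, in which $X,Y$ are adjacent if and only if some $x\in X$, $y\in Y$ are adjacent. $H$ is considered with all constant relations $C_a=\{a\}$, $a\in V(H)$; in $H^\ell$ the relation $C_a$ is $\{(a,\dots,a)\}$, and in $H^\ell/R$ it is $\{[(a,\dots,a)]\}$. Automorphisms of these structures have to preserve these relations. A $p$-automorphism is an automorphism of order $p$; an automorphism of $H^\ell$ is *local* if it induces the identity on $H^\ell/R$. Let $H$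 be a connected bipartite graph and $\ell\ge 0$. 1. Let $H\cong H_1\diamond\dots\diamond H_k$ with all $H_j$ prime bipartite graphs. For a vertex $x=(x_1,\dots,x_\ell)$ of $H^\ell$ with $x_i=(x_{i,1},\dots,x_{i,k})$, $x_{i,j}\in V(H_j)$, put $a_{i,j}(x)=[x_{i,j}]\in V(H_j/R)$. Let $\varphi$ be an automorphism of $H^\ell/R$ with its constant relations that is induced by an automorphism of the graph $H^\ell$. Then there are permutations $\pi_1,\dots,\pi_k$ of $\{1,\dots,\ell\}$ such that for all vertices $x,y$ of $H^\ell$: $\varphi([x])=[y]$ if and only if $x,y$ lie in the same part of $H^\ell$ and $a_{i,j}(y)=a_{\pi_j(i),j}(x)$ for all $i\in\{1,\dots,\ell\}$, $j\in\{1,\dots,k\}$. In short, $$\varphi(a_{1,1},\dots,a_{1,k},\dots,a_{\ell,1},\dots,a_{\ell,k})=(a_{\pi_1(1),1},\dots,a_{\pi_k(1),k},\dots,a_{\pi_1(\ell),1},\dots,a_{\pi_k(\ell),k}).$$ 2. If $p$ is a prime and $\ell<p$, then every $p$-automorphism of $H^\ell$ (with its constant relations) is local. -/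

import Mathlib

universe u v

/-- A finite simple bipartite graph with a fixed bipartition, i.e. a two-sorted graph: `side v`
tells in which of the two parts (left or right) the vertex `v` lies, and edges join vertices of
different parts. -/
structure BipGraph where
  V : Type u
  graph : SimpleGraph V
  side : V → Bool
  side_ne : ∀ {x y : V}, graph.Adj x y → side x ≠ side y
  finite : Finite V

namespace BipGraph

/-- Isomorphisms of two-sorted graphs: bijections that preserve and reflect edges, and map left
vertices to left vertices and right vertices to right vertices. -/
def IsIso (G H : BipGraph.{u}) (e : G.V ≃ H.V) : Prop :=
  (∀ x, H.side (e x) = G.side x) ∧ ∀ x y, H.graph.Adj (e x) (e y) ↔ G.graph.Adj x y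

/-- The graph that consists of a single edge and its two ends. -/
def IsEdge (G : BipGraph.{u}) : Prop :=
  ∃ x y : G.V, G.graph.Adj x y ∧ ∀ z, z = x ∨ z = y

/-- Vertices of a diamond product: tuples of vertices that all lie on the same side. The side is
recorded, so that the empty product is the single edge, the neutral element of the product. -/
@[ext]
structure DiamondVertex {ι : Type} (Hs : ι → BipGraph.{u}) where
  side : Bool
  coord : ∀ i, (Hs i).V
  side_coord : ∀ i, (Hs i).side (coord i) = side

theorem DiamondVertex.finite {ι : Type} [Finite ι] (Hs : ι → BipGraph.{u}) :
    Finite (DiamondVertex Hs) := by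
  have : ∀ i, Finite (Hs i).V := fun i => (Hs i).finite
  refine Finite.of_injective
    (fun x : DiamondVertex Hs => ((x.side, x.coord) : Bool × ∀ i, (Hs i).V)) ?_
  intro x y h
  have h1 : x.side = y.side := congrArg Prod.fst h
  have h2 : x.coord = y.coord := congrArg Prod.snd h
  exact DiamondVertex.ext h1 h2

/-- The diamond product of a finite family of two-sorted bipartite graphs. (For a non-empty family
the first condition on edges follows from the second.) -/
def diamond {ι : Type} [Finite ι] (Hs : ι → BipGraph.{u}) : BipGraph.{u} where
  V := DiamondVertex Hs
  graph :=
    { Adj := fun x y => x.side ≠ y.side ∧ ∀ i, (Hs i).graph.Adj (x.coord i) (y.coord i)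
      symm := ⟨fun _ _ h => ⟨h.1.symm, fun i => (h.2 i).symm⟩⟩
      loopless := ⟨fun _ h => h.1 rfl⟩ }
  side := DiamondVertex.side
  side_ne := fun h => h.1
  finite := DiamondVertex.finite Hs

/-- The `ℓ`-th diamond power, which is the `ℓ`-th direct power in the category of two-sorted
graphs. -/
def power (H : BipGraph.{u}) (ℓ : ℕ) : BipGraph.{u} :=
  diamond (fun _ : Fin ℓ => H)

/-- `G` is prime if whenever `G ≅ A ⋄ B`, one of `A`, `B` is a single edge. -/
def IsPrime (G : BipGraph.{u}) : Prop :=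
  ∀ (A B : BipGraph.{u}) (e : G.V ≃ (diamond ![A, B]).V),
    IsIso G (diamond ![A, B]) e → A.IsEdge ∨ B.IsEdge

/-- The relation `R`: two vertices (of the same sort) are related if they have the same
neighbours. -/
def relR (G : BipGraph.{u}) : Setoid G.V where
  r x y := G.side x = G.side y ∧ G.graph.neighborSet x = G.graph.neighborSet y
  iseqv :=
    ⟨fun _ => ⟨rfl, rfl⟩, fun h => ⟨h.1.symm, h.2.symm⟩,
      fun h h' => ⟨h.1.trans h'.1, h.2.trans h'.2⟩⟩

/-- The `R`-class `[x]` of a vertex. -/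
def cls (G : BipGraph.{u}) (x : G.V) : Quotient G.relR :=
  Quotient.mk G.relR x

/-- The side of an `R`-class. -/
def clsSide (G : BipGraph.{u}) : Quotient G.relR → Bool :=
  Quotient.lift G.side (fun _ _ h => h.1)

/-- The quotient graph `G/R`. -/
def quot (G : BipGraph.{u}) : BipGraph.{u} where
  V := Quotient G.relR
  graph :=
    { Adj := fun X Y => ∃ x y, G.cls x = X ∧ G.cls y = Y ∧ G.graph.Adj x y
      symm := ⟨fun _ _ ⟨x, y, hx, hy, h⟩ => ⟨y, x, hy, hx, h.symm⟩⟩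
      loopless := ⟨fun _ ⟨_, _, hx, hy, h⟩ =>
        G.side_ne h (congrArg G.clsSide (hx.trans hy.symm))⟩ }
  side := G.clsSide
  side_ne := by
    rintro X Y ⟨x, y, rfl, rfl, h⟩
    exact G.side_ne h
  finite := by
    have := G.finite
    exact Finite.of_surjective (Quotient.mk G.relR) Quotient.mk_surjective

end BipGraph

/-- A two-sorted bipartite graph expanded by a family of unary relations indexed by `A`. -/
structure BipStructure (A : Type v) extends BipGraph.{u} where
  rel : A → Set V

namespace BipStructure

variable {A : Type v}

/-- Automorphisms of the expanded structure (which is finite, so that the injective endomorphisms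
are the bijections that preserve and reflect all relations). -/
def IsAut (S : BipStructure.{u, v} A) (σ : Equiv.Perm S.V) : Prop :=
  BipGraph.IsIso S.toBipGraph S.toBipGraph σ ∧ ∀ a x, σ x ∈ S.rel a ↔ x ∈ S.rel a

/-- The direct power of the expanded structure. -/
def power (S : BipStructure.{u, v} A) (ℓ : ℕ) : BipStructure.{u, v} A where
  toBipGraph := S.toBipGraph.power ℓ
  rel := fun a => {x : BipGraph.DiamondVertex _ | ∀ i, x.coord i ∈ S.rel a}

/-- The factor structure modulo `R`. -/
def quot (S : BipStructure.{u, v} A) : BipStructure.{u, v} A where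
  toBipGraph := S.toBipGraph.quot
  rel := fun a => S.toBipGraph.cls '' S.rel a

/-- An automorphism is local if it induces the identity mapping on the quotient modulo `R`. -/
def IsLocal (S : BipStructure.{u, v} A) (σ : Equiv.Perm S.V) : Prop :=
  ∀ x, S.toBipGraph.cls (σ x) = S.toBipGraph.cls x

end BipStructure

/-- The graph `H` expanded by all constant relations `C_a = {a}`. -/
def BipGraph.withConstants (H : BipGraph.{u}) : BipStructure.{u, u} H.V where
  toBipGraph := H
  rel := fun a => {a}

/-- The vertex `x_i` of `H` in the `i`-th coordinate of a vertex `x` of the power. -/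
def BipGraph.powerCoord (H : BipGraph.{u}) {ℓ : ℕ} (x : (H.withConstants.power ℓ).V)
    (i : Fin ℓ) : H.V :=
  BipGraph.DiamondVertex.coord x i

/-- For an isomorphism `e` of `H` with the diamond product of the graphs `Hs j`, the element
`a_{i,j} = [x_{i,j}]` of `(Hs j)/R`, where `x_{i,j}` is the `j`-th coordinate of the `i`-th
coordinate of the vertex `x` of the power of `H`. -/
def BipGraph.factorCoord (H : BipGraph.{u}) {k ℓ : ℕ} (Hs : Fin k → BipGraph.{u})
    (e : H.V ≃ (BipGraph.diamond Hs).V) (x : (H.withConstants.power ℓ).V)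
    (i : Fin ℓ) (j : Fin k) : (Hs j).quot.V :=
  (Hs j).cls (BipGraph.DiamondVertex.coord (e (H.powerCoord x i)) j)

namespace BipGraph

/-! ### Classes and decompositions -/

/-! Everything rests on a pseudometric intrinsic to the graph. In a diamond product, neighbourhoods
are products, so counts of common neighbours multiply and their logarithms add. The largest
pseudometric `dist` bounded by `gap` on pairs with a common neighbour is therefore the sum of the
pseudometrics of the factors (`IsDecomp.dist_eq`), and it vanishes exactly on R-equivalent vertices
of the same side. Given two decompositions `A ⋄ B` and `C ⋄ D` of one graph, metric betweenness in
one passes to the factors of the other (`IsDecomp.dist_add_dist`). Hence, up to R, a layer of `A` is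
a box in `C ⋄ D`. The class sizes on this box form a matrix of rank one, which factors over the
natural numbers, so `A` is itself a diamond product of two blow-ups. If `A` is prime, one of them is
an edge, and the class in `A` depends on only one of `C`, `D` (`IsDecomp.refinement`). Applied to an
automorphism of the power, this shows that, up to R, each nontrivial prime coordinate of the image
depends on a single coordinate of the argument. The constants force that coordinate to belong to the
same prime factor and the dependence to be the identity, which leaves one permutation of the indices
per factor (`exists_perm_of_cls_const`). These permutations have order dividing `ℓ!`, which is
coprime to `p` when `ℓ < p`; this gives locality. -/

theorem cls_eq_iff {G : BipGraph.{u}} {x y : G.V} :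
    G.cls x = G.cls y ↔
      G.side x = G.side y ∧ G.graph.neighborSet x = G.graph.neighborSet y :=
  Quotient.eq

theorem side_eq_of_cls_eq {G : BipGraph.{u}} {x y : G.V} (h : G.cls x = G.cls y) :
    G.side x = G.side y :=
  (cls_eq_iff.1 h).1

theorem adj_iff_of_cls_eq {G : BipGraph.{u}} {x y z : G.V} (h : G.cls x = G.cls y) :
    G.graph.Adj x z ↔ G.graph.Adj y z := by
  have := (cls_eq_iff.1 h).2
  exact Set.ext_iff.1 this z

theorem quot_adj_cls {G : BipGraph.{u}} {x y : G.V} :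
    G.quot.graph.Adj (G.cls x) (G.cls y) ↔ G.graph.Adj x y := by
  refine ⟨?_, fun h => ⟨x, y, rfl, rfl, h⟩⟩
  rintro ⟨x', y', hx, hy, h⟩
  rw [← adj_iff_of_cls_eq hx, SimpleGraph.adj_comm, ← adj_iff_of_cls_eq hy]
  exact h.symm

theorem side_eq_of_adj_of_adj {G : BipGraph.{u}} {x y z : G.V} (hx : G.graph.Adj x z)
    (hy : G.graph.Adj y z) : G.side x = G.side y := by
  have h1 := G.side_ne hx
  have h2 := G.side_ne hy
  revert h1 h2
  cases G.side x <;> cases G.side y <;> cases G.side z <;> simp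

/-- `f` and `g` are the projections of a decomposition of `G` as the diamond product of `A`
and `B`. -/
structure IsDecomp (G A B : BipGraph.{u}) (f : G.V → A.V) (g : G.V → B.V) : Prop where
  side_left : ∀ x, A.side (f x) = G.side x
  side_right : ∀ x, B.side (g x) = G.side x
  adj : ∀ x y, G.graph.Adj x y ↔ A.graph.Adj (f x) (f y) ∧ B.graph.Adj (g x) (g y)
  inj : ∀ x y, f x = f y → g x = g y → x = y
  surj : ∀ a b, A.side a = B.side b → ∃ x, f x = a ∧ g x = b

theorem IsDecomp.symm {G A B : BipGraph.{u}} {f : G.V → A.V} {g : G.V → B.V}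
    (h : IsDecomp G A B f g) : IsDecomp G B A g f where
  side_left := h.side_right
  side_right := h.side_left
  adj x y := (h.adj x y).trans and_comm
  inj x y h1 h2 := h.inj x y h2 h1
  surj b a hab := (h.surj a b hab.symm).imp fun _ hx => hx.symm

theorem IsDecomp.comp_iso {G G' A B : BipGraph.{u}} {f : G.V → A.V} {g : G.V → B.V}
    (h : IsDecomp G A B f g) {e : G'.V ≃ G.V} (he : IsIso G' G e) :
    IsDecomp G' A B (f ∘ e) (g ∘ e) where
  side_left x := (h.side_left _).trans (he.1 x)
  side_right x := (h.side_right _).trans (he.1 x)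
  adj x y := (he.2 x y).symm.trans (h.adj _ _)
  inj x y h1 h2 := e.injective (h.inj _ _ h1 h2)
  surj a b hab := by
    obtain ⟨x, hx⟩ := h.surj a b hab
    exact ⟨e.symm x, by simpa using hx⟩

theorem IsIso.symm {G G' : BipGraph.{u}} {e : G.V ≃ G'.V} (he : IsIso G G' e) :
    IsIso G' G e.symm :=
  ⟨fun x => by rw [← he.1, e.apply_symm_apply],
    fun x y => by rw [← he.2, e.apply_symm_apply, e.apply_symm_apply]⟩

theorem IsIso.trans {G G' G'' : BipGraph.{u}} {e : G.V ≃ G'.V} {e' : G'.V ≃ G''.V}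
    (he : IsIso G G' e) (he' : IsIso G' G'' e') : IsIso G G'' (e.trans e') :=
  ⟨fun x => (he'.1 _).trans (he.1 x), fun x y => (he'.2 _ _).trans (he.2 x y)⟩

theorem IsIso.cls_eq_iff {G G' : BipGraph.{u}} {e : G.V ≃ G'.V} (he : IsIso G G' e)
    {x y : G.V} : G'.cls (e x) = G'.cls (e y) ↔ G.cls x = G.cls y := by
  rw [BipGraph.cls_eq_iff, BipGraph.cls_eq_iff, he.1, he.1]
  refine and_congr_right fun _ => ?_
  rw [Set.ext_iff, Set.ext_iff, ← e.forall_congr_right]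
  simp only [SimpleGraph.mem_neighborSet, he.2]

/-! ### Decompositions of diamond products -/

theorem isDecomp_diamond_pair (A B : BipGraph.{u}) :
    IsDecomp (diamond ![A, B]) A B (fun x => DiamondVertex.coord x 0)
      (fun x => DiamondVertex.coord x 1) where
  side_left x := DiamondVertex.side_coord x 0
  side_right x := DiamondVertex.side_coord x 1
  adj x y := by
    constructor
    · intro hxy
      exact ⟨hxy.2 0, hxy.2 1⟩
    · intro hxy
      have hx : A.side (DiamondVertex.coord x 0) = x.side := DiamondVertex.side_coord x 0
      have hy : A.side (DiamondVertex.coord y 0) = y.side := DiamondVertex.side_coord y 0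
      refine ⟨hx ▸ hy ▸ A.side_ne hxy.1, fun i => ?_⟩
      match i with
      | 0 => exact hxy.1
      | 1 => exact hxy.2
  inj x y h1 h2 := by
    have hx : A.side (DiamondVertex.coord x 0) = x.side := DiamondVertex.side_coord x 0
    have hy : A.side (DiamondVertex.coord y 0) = y.side := DiamondVertex.side_coord y 0
    refine DiamondVertex.ext (hx ▸ hy ▸ congrArg A.side h1) ?_
    funext i
    match i with
    | 0 => exact h1
    | 1 => exact h2
  surj a b hab :=
    ⟨⟨A.side a, Fin.cons a (Fin.cons b finZeroElim), by
      intro i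
      match i with
      | 0 => rfl
      | 1 => exact hab.symm⟩, rfl, rfl⟩

variable {ι : Type} [Finite ι]

theorem isDecomp_diamond (Hs : ι → BipGraph.{u}) (m : ι) :
    IsDecomp (diamond Hs) (Hs m) (diamond fun n : {n // n ≠ m} => Hs n)
      (fun x => DiamondVertex.coord x m)
      (fun x => ⟨DiamondVertex.side x, fun n => DiamondVertex.coord x n,
        fun n => DiamondVertex.side_coord x n⟩) where
  side_left x := DiamondVertex.side_coord x m
  side_right x := rfl
  adj x y := by
    constructor
    · intro h
      exact ⟨h.2 m, h.1, fun n => h.2 n⟩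
    · rintro ⟨h1, h2, h3⟩
      refine ⟨h2, fun n => ?_⟩
      by_cases hn : n = m
      · subst hn
        exact h1
      · exact h3 ⟨n, hn⟩
  inj x y h1 h2 := by
    refine DiamondVertex.ext (congrArg
      (fun z : DiamondVertex (fun n : {n // n ≠ m} => Hs n) => z.side) h2) ?_
    funext n
    by_cases hn : n = m
    · subst hn
      exact h1
    · exact congrFun (congrArg
          (fun z : DiamondVertex (fun n : {n // n ≠ m} => Hs n) => z.coord) h2) ⟨n, hn⟩
  surj a b hab := by
    classical
    refine ⟨⟨DiamondVertex.side b, fun n => if hn : n = m then hn ▸ a else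
      DiamondVertex.coord b ⟨n, hn⟩, fun n => ?_⟩, ?_, ?_⟩
    · by_cases hn : n = m
      · subst hn
        rw [dif_pos rfl]
        exact hab
      · simpa [hn] using DiamondVertex.side_coord b ⟨n, hn⟩
    · simp
    · refine DiamondVertex.ext rfl ?_
      funext n
      simp [n.2]

/-- A reflexive and transitive relation that relates vertices of a diamond product differing in
one coordinate relates all vertices on the same side. -/
theorem diamond_induction (Hs : ι → BipGraph.{u}) (r : (diamond Hs).V → (diamond Hs).V → Prop)
    (hrefl : ∀ x, r x x) (htrans : ∀ x y z, r x y → r y z → r x z)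
    (hstep : ∀ (m : ι) (x y : (diamond Hs).V), (diamond Hs).side x = (diamond Hs).side y →
      (∀ n, n ≠ m → DiamondVertex.coord x n = DiamondVertex.coord y n) → r x y)
    (x y : (diamond Hs).V) (hxy : (diamond Hs).side x = (diamond Hs).side y) : r x y := by
  classical
  have := Fintype.ofFinite ι
  let mix : Finset ι → (diamond Hs).V := fun S =>
    ⟨DiamondVertex.side x, fun n => if n ∈ S then DiamondVertex.coord y n else
      DiamondVertex.coord x n, fun n => by
        split_ifs
        · exact (DiamondVertex.side_coord y n).trans hxy.symm
        · exact DiamondVertex.side_coord x n⟩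
  have key : ∀ S, r x (mix S) := by
    intro S
    induction S using Finset.induction_on with
    | empty =>
      have : mix ∅ = x := DiamondVertex.ext rfl (by funext n; simp [mix])
      rw [this]
      exact hrefl x
    | insert m S _ ih =>
      refine htrans _ _ _ ih (hstep m _ _ rfl fun n hn => ?_)
      simp [mix, hn]
  have h : mix Finset.univ = y := DiamondVertex.ext hxy (by funext n; simp [mix])
  exact h ▸ key Finset.univ

end BipGraph

namespace BipGraph

/-! ### An additive pseudometric -/

/-- The number of common neighbours. -/
noncomputable def numCommon (G : BipGraph.{u}) (x y : G.V) : ℕ :=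
  (G.graph.neighborSet x ∩ G.graph.neighborSet y).ncard

/-- A logarithmic measure of how much the neighbourhoods of `x` and `y` differ. -/
noncomputable def gap (G : BipGraph.{u}) (x y : G.V) : ℝ :=
  Real.log (G.numCommon x x) + Real.log (G.numCommon y y) - 2 * Real.log (G.numCommon x y)

/-- Functions that change by at most `gap x y` between vertices with a common neighbour. -/
def IsLip (G : BipGraph.{u}) (f : G.V → ℝ) : Prop :=
  ∀ x y z, G.graph.Adj x z → G.graph.Adj y z → f y - f x ≤ G.gap x y

/-- Non-empty graphs without isolated vertices in which the pseudometric `dist` is finite on each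
of the two sides. -/
structure IsGood (G : BipGraph.{u}) : Prop where
  nonempty : Nonempty G.V
  exists_adj : ∀ x, ∃ y, G.graph.Adj x y
  bounded : ∀ x y, G.side x = G.side y → ∃ C : ℝ, ∀ f, G.IsLip f → f y - f x ≤ C

/-- The largest pseudometric bounded by `gap` on pairs of vertices with a common neighbour. -/
noncomputable def dist (G : BipGraph.{u}) (x y : G.V) : ℝ :=
  sSup {r | ∃ f, G.IsLip f ∧ r = f y - f x}

section

variable {G : BipGraph.{u}}

theorem numCommon_comm (x y : G.V) : G.numCommon x y = G.numCommon y x := by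
  rw [numCommon, Set.inter_comm, numCommon]

theorem gap_comm (x y : G.V) : G.gap x y = G.gap y x := by
  rw [gap, gap, numCommon_comm x y]
  ring

theorem numCommon_pos {x y z : G.V} (hx : G.graph.Adj x z) (hy : G.graph.Adj y z) :
    0 < G.numCommon x y := by
  have := G.finite
  exact (Set.ncard_pos (Set.toFinite _)).2 ⟨z, hx, hy⟩

theorem numCommon_le (x y : G.V) : G.numCommon x y ≤ G.numCommon x x := by
  have := G.finite
  refine Set.ncard_le_ncard ?_ (Set.toFinite _)
  rw [Set.inter_self]
  exact Set.inter_subset_left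

theorem gap_nonneg {x y z : G.V} (hx : G.graph.Adj x z) (hy : G.graph.Adj y z) :
    0 ≤ G.gap x y := by
  have h0 : (0 : ℝ) < G.numCommon x y := by exact_mod_cast numCommon_pos hx hy
  have h1 := Real.log_le_log h0 (by exact_mod_cast numCommon_le x y :
    (G.numCommon x y : ℝ) ≤ G.numCommon x x)
  have h2 := Real.log_le_log h0 (by exact_mod_cast numCommon_comm x y ▸ numCommon_le y x :
    (G.numCommon x y : ℝ) ≤ G.numCommon y y)
  rw [gap]
  linarith

/-- The gap is the sum of `log (|N x| / |N x ∩ N y|)` and its mirror image, both nonnegative. If it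
vanishes, the intersection has the full size of `N x`. -/
theorem neighborSet_subset_of_gap_eq_zero {x y z : G.V} (hx : G.graph.Adj x z)
    (hy : G.graph.Adj y z) (h : G.gap x y = 0) :
    G.graph.neighborSet x ⊆ G.graph.neighborSet y := by
  have := G.finite
  have h0 : (0 : ℝ) < G.numCommon x y := by exact_mod_cast numCommon_pos hx hy
  have h1 := Real.log_le_log h0 (by exact_mod_cast numCommon_le x y :
    (G.numCommon x y : ℝ) ≤ G.numCommon x x)
  have h2 := Real.log_le_log h0 (by exact_mod_cast numCommon_comm x y ▸ numCommon_le y x :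
    (G.numCommon x y : ℝ) ≤ G.numCommon y y)
  rw [gap] at h
  have h3 : (G.numCommon x x : ℝ) ≤ G.numCommon x y := by
    have hpos : (0 : ℝ) < G.numCommon x x := by exact_mod_cast numCommon_pos hx hx
    rw [← Real.log_le_log_iff hpos h0]
    linarith
  have h4 : (G.graph.neighborSet x).ncard ≤
      (G.graph.neighborSet x ∩ G.graph.neighborSet y).ncard := by
    have : G.numCommon x x ≤ G.numCommon x y := by exact_mod_cast h3
    simpa [numCommon] using this
  have h5 := Set.eq_of_subset_of_ncard_le Set.inter_subset_left h4 (Set.toFinite _)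
  exact Set.inter_eq_left.1 h5

theorem gap_eq_zero_of_cls_eq {x y : G.V} (h : G.cls x = G.cls y) : G.gap x y = 0 := by
  have := (cls_eq_iff.1 h).2
  rw [gap, numCommon, numCommon, numCommon, this]
  ring

theorem isLip_zero : G.IsLip (fun _ => 0) := fun x y z hx hy => by
  simpa using gap_nonneg hx hy

theorem IsLip.neg {f : G.V → ℝ} (hf : G.IsLip f) : G.IsLip (fun x => -f x) :=
  fun x y z hx hy => by
    have := hf y x z hy hx
    rw [gap_comm] at this
    linarith

variable (hG : G.IsGood)
include hG

/-- Boundedness is essential here, since the real `sSup` of an unbounded set is 0 by convention. The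
opposite estimate `dist_le` needs only the zero function. -/
theorem IsGood.le_dist {x y : G.V} (hxy : G.side x = G.side y) {f : G.V → ℝ} (hf : G.IsLip f) :
    f y - f x ≤ G.dist x y := by
  obtain ⟨C, hC⟩ := hG.bounded x y hxy
  refine le_csSup ⟨C, ?_⟩ ⟨f, hf, rfl⟩
  rintro _ ⟨f, hf, rfl⟩
  exact hC f hf

omit hG in
theorem dist_le {x y : G.V} {C : ℝ} (h : ∀ f, G.IsLip f → f y - f x ≤ C) : G.dist x y ≤ C := by
  refine csSup_le ⟨_, _, isLip_zero, rfl⟩ ?_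
  rintro _ ⟨f, hf, rfl⟩
  exact h f hf

theorem IsGood.dist_nonneg {x y : G.V} (hxy : G.side x = G.side y) : 0 ≤ G.dist x y := by
  simpa using hG.le_dist hxy isLip_zero

theorem IsGood.dist_comm {x y : G.V} (hxy : G.side x = G.side y) : G.dist x y = G.dist y x := by
  have key : ∀ {x y : G.V}, G.side x = G.side y → G.dist x y ≤ G.dist y x := by
    intro x y hxy
    refine dist_le fun f hf => ?_
    have := hG.le_dist hxy.symm hf.neg
    linarith
  exact le_antisymm (key hxy) (key hxy.symm)

theorem IsGood.dist_triangle {x y z : G.V} (hxy : G.side x = G.side y)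
    (hyz : G.side y = G.side z) : G.dist x z ≤ G.dist x y + G.dist y z := by
  refine dist_le fun f hf => ?_
  have h1 := hG.le_dist hxy hf
  have h2 := hG.le_dist hyz hf
  linarith

theorem IsGood.dist_eq_zero_of_cls_eq {x y : G.V} (h : G.cls x = G.cls y) : G.dist x y = 0 := by
  refine le_antisymm (dist_le fun f hf => ?_) (hG.dist_nonneg (side_eq_of_cls_eq h))
  obtain ⟨z, hz⟩ := hG.exists_adj x
  rw [← gap_eq_zero_of_cls_eq h]
  exact hf x y z hz ((adj_iff_of_cls_eq h).1 hz)

/-- Inequivalent vertices with a common neighbour have positive gap. As the graph is finite, these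
gaps have a positive lower bound `ε`, so the function that is 0 on the class of `x` and `ε`
elsewhere is Lipschitz and separates `x` from every other class. -/
theorem IsGood.cls_eq_of_dist_eq_zero {x y : G.V} (hxy : G.side x = G.side y)
    (h : G.dist x y = 0) : G.cls x = G.cls y := by
  classical
  by_contra hne
  have := G.finite
  have := Fintype.ofFinite G.V
  have hε : ∃ ε : ℝ, 0 < ε ∧ ∀ a b, 0 < G.gap a b → ε ≤ G.gap a b := by
    -- The extra element 1 provides a minimum even if no gap is positive.
    let S : Finset ℝ := insert 1 ((Finset.univ.image fun p : G.V × G.V => G.gap p.1 p.2).filter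
      (0 < ·))
    have hS : S.Nonempty := ⟨1, by simp [S]⟩
    refine ⟨S.min' hS, ?_, fun a b hab => Finset.min'_le _ _ ?_⟩
    · have := S.min'_mem hS
      simp only [S, Finset.mem_insert, Finset.mem_filter] at this
      rcases this with h1 | h1
      · simp only [S, h1]
        exact one_pos
      · exact h1.2
    · simp only [S, Finset.mem_insert, Finset.mem_filter, Finset.mem_image, Finset.mem_univ,
        true_and]
      exact Or.inr ⟨⟨(a, b), rfl⟩, hab⟩
  obtain ⟨ε, hε0, hε⟩ := hε
  have hf : G.IsLip (fun z => if G.cls z = G.cls x then 0 else ε) := by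
    intro a b z ha hb
    have h0 := gap_nonneg ha hb
    by_cases hab : G.cls a = G.cls b
    · simpa [hab] using h0
    · have h1 : 0 < G.gap a b := by
        refine lt_of_le_of_ne h0 fun h1 => hab (cls_eq_iff.2 ⟨side_eq_of_adj_of_adj ha hb, ?_⟩)
        exact Set.Subset.antisymm (neighborSet_subset_of_gap_eq_zero ha hb h1.symm)
          (neighborSet_subset_of_gap_eq_zero hb ha (gap_comm b a ▸ h1.symm))
      have h2 := hε a b h1
      dsimp only
      split_ifs <;> linarith
  have h1 := hG.le_dist hxy hf
  rw [h, if_neg (fun h => hne h.symm), if_pos rfl] at h1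
  linarith

end

/-! ### Additivity -/

section

variable {G A B : BipGraph.{u}} {f : G.V → A.V} {g : G.V → B.V}

theorem IsDecomp.numCommon_eq (h : IsDecomp G A B f g) (x y : G.V) :
    G.numCommon x y = A.numCommon (f x) (f y) * B.numCommon (g x) (g y) := by
  rw [numCommon, numCommon, numCommon, ← Set.ncard_prod,
    ← Set.ncard_image_of_injective (f := fun z => (f z, g z)) _
      (fun z w hzw => h.inj z w (congrArg Prod.fst hzw) (congrArg Prod.snd hzw))]
  congr 1
  ext ⟨a, b⟩
  simp only [Set.mem_image, Set.mem_inter_iff, SimpleGraph.mem_neighborSet, Set.mem_prod,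
    Prod.mk.injEq, h.adj]
  constructor
  · rintro ⟨z, ⟨h1, h2⟩, rfl, rfl⟩
    exact ⟨⟨h1.1, h2.1⟩, h1.2, h2.2⟩
  · rintro ⟨⟨h1, h2⟩, h3, h4⟩
    -- Both lie opposite to `x`, so the pair is a vertex of the product.
    have hs : A.side a = B.side b := by
      have e1 := A.side_ne h1
      have e2 := B.side_ne h3
      rw [h.side_left] at e1
      rw [h.side_right] at e2
      rw [Bool.eq_not_iff.2 e1.symm, Bool.eq_not_iff.2 e2.symm]
    obtain ⟨z, rfl, rfl⟩ := h.surj a b hs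
    exact ⟨z, ⟨⟨h1, h3⟩, h2, h4⟩, rfl, rfl⟩

/-- The common neighbour `z` keeps all counts positive; otherwise the convention `log 0 = 0` would
spoil additivity. -/
theorem IsDecomp.gap_eq (h : IsDecomp G A B f g) {x y z : G.V} (hx : G.graph.Adj x z)
    (hy : G.graph.Adj y z) : G.gap x y = A.gap (f x) (f y) + B.gap (g x) (g y) := by
  have hx1 := (h.adj x z).1 hx
  have hy1 := (h.adj y z).1 hy
  have key : ∀ {x y z}, G.graph.Adj x z → G.graph.Adj y z → Real.log (G.numCommon x y) =
      Real.log (A.numCommon (f x) (f y)) + Real.log (B.numCommon (g x) (g y)) := by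
    intro x y z hx hy
    have hx1 := (h.adj x z).1 hx
    have hy1 := (h.adj y z).1 hy
    rw [h.numCommon_eq, Nat.cast_mul, Real.log_mul]
    · exact_mod_cast (numCommon_pos hx1.1 hy1.1).ne'
    · exact_mod_cast (numCommon_pos hx1.2 hy1.2).ne'
  rw [gap, gap, gap, key hx hx, key hy hy, key hx hy]
  ring

theorem IsDecomp.isLip_comp (h : IsDecomp G A B f g) {F : A.V → ℝ} (hF : A.IsLip F) :
    G.IsLip (F ∘ f) := by
  intro x y z hx hy
  have hx1 := (h.adj x z).1 hx
  have hy1 := (h.adj y z).1 hy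
  have h1 := hF _ _ _ hx1.1 hy1.1
  have h2 := gap_nonneg hx1.2 hy1.2
  rw [h.gap_eq hx hy, Function.comp, Function.comp]
  linarith

theorem IsDecomp.isLip_add (h : IsDecomp G A B f g) {F : A.V → ℝ} (hF : A.IsLip F)
    {F' : B.V → ℝ} (hF' : B.IsLip F') : G.IsLip (fun x => F (f x) + F' (g x)) := by
  intro x y z hx hy
  have hx1 := (h.adj x z).1 hx
  have hy1 := (h.adj y z).1 hy
  have h1 := hF _ _ _ hx1.1 hy1.1
  have h2 := hF' _ _ _ hx1.2 hy1.2
  rw [h.gap_eq hx hy]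
  linarith

/-- Fixing an edge in one factor embeds the other factor into the product, with adjacency in the
fixed factor automatic between opposite sides. -/
theorem IsGood.exists_edge (hG : G.IsGood) :
    ∃ b : Bool → G.V, (∀ s, G.side (b s) = s) ∧ ∀ s t, s ≠ t → G.graph.Adj (b s) (b t) := by
  obtain ⟨x⟩ := hG.nonempty
  obtain ⟨y, hy⟩ := hG.exists_adj x
  have hne := G.side_ne hy
  have hnot : G.side y = !G.side x := Bool.eq_not_iff.2 hne.symm
  refine ⟨fun s => if s = G.side x then x else y, fun s => ?_, fun s t hst => ?_⟩
  · by_cases hs : s = G.side x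
    · simp only [hs, if_true]
    · simp only [if_neg hs, hnot]
      exact (Bool.eq_not_iff.2 hs).symm
  · by_cases hs : s = G.side x
    · have ht : t ≠ G.side x := fun ht => hst (hs.trans ht.symm)
      simpa [hs, ht] using hy
    · have ht : t = G.side x := by
        rw [Bool.eq_not_iff.2 hst.symm, Bool.eq_not_iff.2 hs, Bool.not_not]
      simpa [hs, ht] using hy.symm

theorem IsGood.exists_side (hG : G.IsGood) (s : Bool) : ∃ x, G.side x = s :=
  let ⟨b, hb, _⟩ := hG.exists_edge
  ⟨b s, hb s⟩

theorem IsDecomp.exists_left (h : IsDecomp G A B f g) (hG : G.IsGood) (a : A.V) :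
    ∃ x, f x = a := by
  obtain ⟨z, hz⟩ := hG.exists_side (A.side a)
  obtain ⟨x, hx, _⟩ := h.surj a (g z) (by rw [h.side_right, hz])
  exact ⟨x, hx⟩

theorem IsDecomp.isGood_left (h : IsDecomp G A B f g) (hG : G.IsGood) : A.IsGood where
  nonempty := hG.nonempty.map f
  exists_adj a := by
    obtain ⟨x, rfl⟩ := h.exists_left hG a
    obtain ⟨y, hy⟩ := hG.exists_adj x
    exact ⟨f y, ((h.adj x y).1 hy).1⟩
  bounded a a' haa := by
    obtain ⟨x, rfl⟩ := h.exists_left hG a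
    obtain ⟨y, rfl⟩ := h.exists_left hG a'
    rw [h.side_left, h.side_left] at haa
    obtain ⟨C, hC⟩ := hG.bounded x y haa
    exact ⟨C, fun F hF => hC _ (h.isLip_comp hF)⟩

/-- A Lipschitz function on `G`, restricted to a layer of a factor. -/
theorem IsDecomp.sub_le_of_right_eq (h : IsDecomp G A B f g)
    (hB : ∀ b, ∃ b', B.graph.Adj b b') {F : G.V → ℝ} (hF : G.IsLip F) {x y : G.V}
    (hxy : g x = g y) : ∃ F', A.IsLip F' ∧ F y - F x = F' (f y) - F' (f x) := by
  have hlift : ∀ a, ∃ z, A.side a = G.side x → f z = a ∧ g z = g x := by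
    intro a
    by_cases ha : A.side a = G.side x
    · obtain ⟨z, hz⟩ := h.surj a (g x) (by rw [ha, h.side_right])
      exact ⟨z, fun _ => hz⟩
    · exact ⟨x, fun h => absurd h ha⟩
  choose σ hσ using hlift
  have hσ' : ∀ z, g z = g x → σ (f z) = z := by
    intro z hz
    have hs : A.side (f z) = G.side x := by
      rw [h.side_left, ← h.side_right, hz, h.side_right]
    exact h.inj _ _ (hσ _ hs).1 ((hσ _ hs).2.trans hz.symm)
  -- The value 0 on the other side is harmless, because the Lipschitz condition only compares
  -- vertices of the same side.
  refine ⟨fun a => if A.side a = G.side x then F (σ a) else 0, ?_, ?_⟩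
  · intro a a' c ha ha'
    have hs := side_eq_of_adj_of_adj ha ha'
    by_cases hsx : A.side a = G.side x
    · have hsx' := hs ▸ hsx
      -- A neighbour of `g x` turns a common neighbour in `A` into one of the lifted vertices in
      -- `G`.
      obtain ⟨b', hb'⟩ := hB (g x)
      obtain ⟨z, hz1, hz2⟩ := h.surj c b' (by
        have e1 := A.side_ne ha
        have e2 := B.side_ne hb'
        rw [hsx] at e1
        rw [h.side_right] at e2
        rw [Bool.eq_not_iff.2 e1.symm, Bool.eq_not_iff.2 e2.symm])
      have hz : G.graph.Adj (σ a) z := by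
        rw [h.adj, (hσ _ hsx).1, (hσ _ hsx).2, hz1, hz2]
        exact ⟨ha, hb'⟩
      have hz' : G.graph.Adj (σ a') z := by
        rw [h.adj, (hσ _ hsx').1, (hσ _ hsx').2, hz1, hz2]
        exact ⟨ha', hb'⟩
      have h1 := hF _ _ _ hz hz'
      rw [h.gap_eq hz hz', (hσ _ hsx).1, (hσ _ hsx).2, (hσ _ hsx').1, (hσ _ hsx').2,
        gap_eq_zero_of_cls_eq rfl, add_zero] at h1
      simpa [hsx, hsx'] using h1
    · have hsx' : A.side a' ≠ G.side x := hs ▸ hsx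
      simpa [hsx, hsx'] using gap_nonneg ha ha'
  · have hy : G.side y = G.side x := by rw [← h.side_right, ← hxy, h.side_right]
    simp [h.side_left, hy, hσ' x rfl, hσ' y hxy.symm]

/-- For `≤`, pass from `x` to `y` through the corner `(f y, g x)`: each leg stays in a layer, where
a Lipschitz function restricts to one of the factor. For `≥`, the sum of Lipschitz functions of the
factors is Lipschitz on `G`, and the two suprema are taken in turn. -/
theorem IsDecomp.dist_eq (h : IsDecomp G A B f g) (hG : G.IsGood) {x y : G.V}
    (hxy : G.side x = G.side y) :
    G.dist x y = A.dist (f x) (f y) + B.dist (g x) (g y) := by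
  have hA := h.isGood_left hG
  have hB := h.symm.isGood_left hG
  have hA' : A.side (f x) = A.side (f y) := by rw [h.side_left, h.side_left, hxy]
  have hB' : B.side (g x) = B.side (g y) := by rw [h.side_right, h.side_right, hxy]
  apply le_antisymm
  · refine dist_le fun F hF => ?_
    obtain ⟨z, hz1, hz2⟩ := h.surj (f y) (g x) (by rw [h.side_left, h.side_right, hxy])
    obtain ⟨F1, hF1, e1⟩ := h.sub_le_of_right_eq hB.exists_adj hF hz2.symm
    obtain ⟨F2, hF2, e2⟩ := h.symm.sub_le_of_right_eq hA.exists_adj hF hz1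
    have h1 := hA.le_dist hA' hF1
    have h2 := hB.le_dist hB' hF2
    rw [hz1] at e1
    rw [hz2] at e2
    linarith
  · have h1 : ∀ F', B.IsLip F' → A.dist (f x) (f y) ≤ G.dist x y - (F' (g y) - F' (g x)) := by
      intro F' hF'
      refine dist_le fun F hF => ?_
      have := hG.le_dist hxy (h.isLip_add hF hF')
      linarith
    have h2 : B.dist (g x) (g y) ≤ G.dist x y - A.dist (f x) (f y) :=
      dist_le fun F' hF' => by
        have := h1 F' hF'
        linarith
    linarith

theorem IsDecomp.cls_eq_iff (h : IsDecomp G A B f g) (hG : G.IsGood) {x y : G.V} :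
    G.cls x = G.cls y ↔ A.cls (f x) = A.cls (f y) ∧ B.cls (g x) = B.cls (g y) := by
  have hA := h.isGood_left hG
  have hB := h.symm.isGood_left hG
  constructor
  · intro hxy
    have hs := side_eq_of_cls_eq hxy
    have hA' : A.side (f x) = A.side (f y) := by rw [h.side_left, h.side_left, hs]
    have hB' : B.side (g x) = B.side (g y) := by rw [h.side_right, h.side_right, hs]
    have h0 := hG.dist_eq_zero_of_cls_eq hxy
    rw [h.dist_eq hG hs] at h0
    have h1 := hA.dist_nonneg hA'
    have h2 := hB.dist_nonneg hB'
    exact ⟨hA.cls_eq_of_dist_eq_zero hA' (by linarith),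
      hB.cls_eq_of_dist_eq_zero hB' (by linarith)⟩
  · rintro ⟨h1, h2⟩
    have hs : G.side x = G.side y := by
      rw [← h.side_left, ← h.side_left]
      exact side_eq_of_cls_eq h1
    refine hG.cls_eq_of_dist_eq_zero hs ?_
    rw [h.dist_eq hG hs, hA.dist_eq_zero_of_cls_eq h1, hB.dist_eq_zero_of_cls_eq h2, add_zero]

/-- Connected graphs with at least two vertices. -/
theorem isGood_of_connected (hG : G.graph.Connected) [Nontrivial G.V] : G.IsGood where
  nonempty := hG.nonempty
  exists_adj x := hG.preconnected.exists_adj_of_nontrivial x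
  bounded := by
    intro x y
    have hr := (SimpleGraph.reachable_iff_reflTransGen x y).1 (hG.preconnected x y)
    -- Gaps control steps of length two. When a walk ends on the wrong side, the induction therefore
    -- bounds all neighbours of its end.
    have key : (G.side x = G.side y → ∃ C : ℝ, ∀ f, G.IsLip f → f y - f x ≤ C) ∧
        (G.side x ≠ G.side y → ∀ z, G.graph.Adj y z → ∃ C : ℝ, ∀ f, G.IsLip f →
          f z - f x ≤ C) := by
      induction hr with
      | refl => exact ⟨fun _ => ⟨0, fun f _ => by simp⟩, fun h => absurd rfl h⟩
      | @tail b c _ hbc ih =>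
        have hne := G.side_ne hbc
        constructor
        · intro h
          exact ih.2 (fun h' => hne (h'.symm.trans h)) c hbc
        · intro h z hz
          have hb : G.side x = G.side b := by
            rw [Bool.eq_not_iff.2 h, Bool.eq_not_iff.2 hne]
          obtain ⟨C, hC⟩ := ih.1 hb
          refine ⟨C + G.gap b z, fun f hf => ?_⟩
          have h1 := hC f hf
          have h2 := hf b z c hbc hz.symm
          linarith
    exact key.1

theorem diamond_exists_adj {ι : Type} [Finite ι] (Hs : ι → BipGraph.{u})
    (hHs : ∀ i, (Hs i).IsGood) (x : (diamond Hs).V) : ∃ y, (diamond Hs).graph.Adj x y := by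
  choose c hc using fun i => (hHs i).exists_adj (DiamondVertex.coord x i)
  have hx := DiamondVertex.side_coord x
  refine ⟨⟨!DiamondVertex.side x, c, fun i => ?_⟩, (Bool.not_ne_self _).symm, hc⟩
  rw [← hx i]
  exact Bool.eq_not_iff.2 ((Hs i).side_ne (hc i)).symm

/-- Changing one coordinate at a time keeps each step inside a layer of one factor, where the bound
of that factor applies; the complementary product only needs to have no isolated vertices. -/
theorem isGood_diamond {ι : Type} [Finite ι] (Hs : ι → BipGraph.{u}) (hHs : ∀ i, (Hs i).IsGood) :
    (diamond Hs).IsGood := by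
  refine ⟨?_, diamond_exists_adj Hs hHs, ?_⟩
  · choose b hb using fun i => (hHs i).exists_side true
    exact ⟨⟨true, b, hb⟩⟩
  · refine diamond_induction Hs _ (fun x => ⟨0, fun f _ => by simp⟩) ?_ ?_
    · rintro x y z ⟨C, hC⟩ ⟨C', hC'⟩
      refine ⟨C + C', fun f hf => ?_⟩
      have h1 := hC f hf
      have h2 := hC' f hf
      linarith
    · intro m x y hxy hn
      have hd := isDecomp_diamond Hs m
      obtain ⟨C, hC⟩ := (hHs m).bounded _ _
        ((hd.side_left x).trans (hxy.trans (hd.side_left y).symm))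
      refine ⟨C, fun f hf => ?_⟩
      have hB := diamond_exists_adj (fun n : {n // n ≠ m} => Hs n) fun n => hHs n
      obtain ⟨F', hF', e⟩ := hd.sub_le_of_right_eq hB hf (x := x) (y := y)
        (DiamondVertex.ext hxy (funext fun n => hn n n.2))
      rw [e]
      exact hC F' hF'

end

end BipGraph

/-! ### Counting lemmas -/

/-- A matrix of natural numbers that has rank one over the rationals is a product of a column and
a row of natural numbers. -/
theorem Nat.exists_eq_mul_of_mul_eq_mul {X Y : Type*} [Finite X] {w : X → Y → ℕ} {κ : X → ℕ}
    {μ : Y → ℕ} {K : ℕ} (hK : 0 < K) (h : ∀ x y, K * w x y = κ x * μ y) :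
    ∃ (a : X → ℕ) (b : Y → ℕ), ∀ x y, w x y = a x * b y := by
  have := Fintype.ofFinite X
  -- Write `K` as `gcd K Γ` times a cofactor. The first divides every `κ x`. The cofactor is coprime
  -- to `Γ / gcd K Γ`, so it divides every `μ y`.
  set Γ := Finset.univ.gcd κ with hΓ
  have hdvd : ∀ y, K ∣ Γ * μ y := by
    intro y
    have h1 : (Finset.univ.gcd fun x => κ x * μ y) = Γ * μ y := by
      rw [Finset.gcd_mul_right, normalize_eq]
    rw [← h1]
    exact Finset.dvd_gcd fun x _ => ⟨w x y, (h x y).symm⟩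
  have hg : 0 < K.gcd Γ := Nat.gcd_pos_of_pos_left _ hK
  have hK' : 0 < K / K.gcd Γ := Nat.div_pos (Nat.le_of_dvd hK (Nat.gcd_dvd_left _ _)) hg
  have hμ : ∀ y, K / K.gcd Γ ∣ μ y := by
    intro y
    have hco : Nat.Coprime (K / K.gcd Γ) (Γ / K.gcd Γ) := Nat.coprime_div_gcd_div_gcd hg
    refine hco.dvd_of_dvd_mul_left ?_
    refine Nat.dvd_of_mul_dvd_mul_left hg ?_
    rw [← mul_assoc, Nat.mul_div_cancel' (Nat.gcd_dvd_left _ _),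
      Nat.mul_div_cancel' (Nat.gcd_dvd_right _ _)]
    exact hdvd y
  have hκ : ∀ x, K.gcd Γ ∣ κ x := fun x =>
    (Nat.gcd_dvd_right _ _).trans (Finset.gcd_dvd (Finset.mem_univ x))
  refine ⟨fun x => κ x / K.gcd Γ, fun y => μ y / (K / K.gcd Γ), fun x y => ?_⟩
  refine Nat.eq_of_mul_eq_mul_left hK ?_
  calc K * w x y = κ x * μ y := h x y
    _ = (K.gcd Γ * (κ x / K.gcd Γ)) * ((K / K.gcd Γ) * (μ y / (K / K.gcd Γ))) := by
        rw [Nat.mul_div_cancel' (hκ x), Nat.mul_div_cancel' (hμ y)]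
    _ = (K.gcd Γ * (K / K.gcd Γ)) * (κ x / K.gcd Γ * (μ y / (K / K.gcd Γ))) := by ring
    _ = _ := by rw [Nat.mul_div_cancel' (Nat.gcd_dvd_left _ _)]

/-- Two maps with fibres of equal sizes differ by a bijection. -/
theorem exists_equiv_comp_eq {X Y Z : Type*} [Finite X] [Finite Y] (f : X → Z) (g : Y → Z)
    (h : ∀ z, {x | f x = z}.ncard = {y | g y = z}.ncard) : ∃ e : X ≃ Y, ∀ x, g (e x) = f x := by
  have h' : ∀ z, Nonempty ({x // f x = z} ≃ {y // g y = z}) := fun z =>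
    Finite.card_eq.1 (h z)
  let e := fun z => (h' z).some
  refine ⟨(Equiv.sigmaFiberEquiv f).symm.trans
    ((Equiv.sigmaCongrRight e).trans (Equiv.sigmaFiberEquiv g)), fun x => ?_⟩
  exact (e (f x) ⟨x, rfl⟩).2

namespace BipGraph

/-! ### Two decompositions of the same graph -/

section

variable {G A B C D : BipGraph.{u}} {f : G.V → A.V} {g : G.V → B.V} {c : G.V → C.V} {d : G.V → D.V}

/-- The corner `y` lies metrically between `x` and `z` in `G`. Adding the triangle inequalities in
`C` and `D` gives an equality, so each of them is an equality. -/
theorem IsDecomp.dist_add_dist (hG : G.IsGood) (h : IsDecomp G A B f g) (k : IsDecomp G C D c d)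
    {x y z : G.V} (hf : f x = f y) (hg : g y = g z) :
    C.dist (c x) (c y) + C.dist (c y) (c z) = C.dist (c x) (c z) := by
  have hA := h.isGood_left hG
  have hB := h.symm.isGood_left hG
  have hC := k.isGood_left hG
  have hD := k.symm.isGood_left hG
  have hxy : G.side x = G.side y := by rw [← h.side_left, hf, h.side_left]
  have hyz : G.side y = G.side z := by rw [← h.side_right, hg, h.side_right]
  have e1 := h.dist_eq hG hxy
  have e2 := h.dist_eq hG hyz
  have e3 := h.dist_eq hG (hxy.trans hyz)
  rw [hf, hA.dist_eq_zero_of_cls_eq rfl] at e1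
  rw [hg, hB.dist_eq_zero_of_cls_eq rfl] at e2
  rw [hf, ← hg] at e3
  have k1 := k.dist_eq hG hxy
  have k2 := k.dist_eq hG hyz
  have k3 := k.dist_eq hG (hxy.trans hyz)
  have c1 : C.side (c x) = C.side (c y) := by rw [k.side_left, k.side_left, hxy]
  have c2 : C.side (c y) = C.side (c z) := by rw [k.side_left, k.side_left, hyz]
  have d1 : D.side (d x) = D.side (d y) := by rw [k.side_right, k.side_right, hxy]
  have d2 : D.side (d y) = D.side (d z) := by rw [k.side_right, k.side_right, hyz]
  have t1 := hC.dist_triangle c1 c2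
  have t2 := hD.dist_triangle d1 d2
  linarith

/-- Layers of one decomposition are boxes in the other one. -/
theorem IsDecomp.cls_right_eq_of_mix (hG : G.IsGood) (h : IsDecomp G A B f g)
    (k : IsDecomp G C D c d) {x y z : G.V} (hxy : g x = g y) (hc : c z = c x) (hd : d z = d y) :
    B.cls (g z) = B.cls (g x) := by
  have hB := h.symm.isGood_left hG
  have hxz : G.side z = G.side x := by rw [← k.side_left, hc, k.side_left]
  have hzy : G.side z = G.side y := by rw [← k.side_right, hd, k.side_right]
  -- In `B`, the point `g z` lies between `g x` and `g y`, which coincide.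
  have h1 := k.dist_add_dist hG h.symm hc.symm hd
  rw [← hxy, hB.dist_eq_zero_of_cls_eq rfl] at h1
  have b1 : B.side (g x) = B.side (g z) := by rw [h.side_right, h.side_right, hxz]
  have h2 := hB.dist_nonneg b1
  have h3 := hB.dist_nonneg b1.symm
  exact (hB.cls_eq_of_dist_eq_zero b1 (by linarith)).symm

/-- Agreement in a factor of one decomposition is preserved by the projection to a layer of the
other one. -/
theorem IsDecomp.cls_left_eq_of_layer (hG : G.IsGood) (h : IsDecomp G A B f g)
    (k : IsDecomp G C D c d) {x y x' y' : G.V} (hxy : C.cls (c x) = C.cls (c y))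
    (hx : f x' = f x) (hy : f y' = f y) (hg : g x' = g y') : C.cls (c x') = C.cls (c y') := by
  have hC := k.isGood_left hG
  have s1 : G.side x = G.side y := by
    rw [← k.side_left, side_eq_of_cls_eq hxy, k.side_left]
  have s2 : G.side x' = G.side x := by rw [← h.side_left, hx, h.side_left]
  have s3 : G.side y' = G.side y := by rw [← h.side_left, hy, h.side_left]
  -- The points `x`, `w`, `y'`, `x'` form a rectangle. Betweenness along its two diagonals makes
  -- opposite sides equally long in `C`, and the side from `x` to `w` has length 0 because `w` lies
  -- between `x` and `y`.
  obtain ⟨w, hw1, hw2⟩ := h.surj (f y) (g x) (by rw [h.side_left, h.side_right, s1])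
  have s4 : G.side w = G.side y := by rw [← h.side_left, hw1, h.side_left]
  have sc : ∀ {p q}, G.side p = G.side q → C.side (c p) = C.side (c q) := by
    intro p q hpq
    rw [k.side_left, k.side_left, hpq]
  have h0 := h.symm.dist_add_dist hG k hw2.symm hw1
  rw [hC.dist_eq_zero_of_cls_eq hxy] at h0
  have n1 := hC.dist_nonneg (sc (s1.trans s4.symm))
  have n2 := hC.dist_nonneg (sc s4)
  have h1 := h.dist_add_dist hG k hx hw2.symm
  have h2 := h.symm.dist_add_dist hG k hg (hy.trans hw1.symm)
  have h3 := h.symm.dist_add_dist hG k hw2.symm (hw1.trans hy.symm)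
  have h4 := h.dist_add_dist hG k hx.symm hg
  have e1 := hC.dist_comm (sc s2)
  have e2 := hC.dist_comm (sc (s3.trans s4.symm))
  exact hC.cls_eq_of_dist_eq_zero (sc (s2.trans (s1.trans s3.symm))) (by linarith)

theorem IsDecomp.ncard_cls (hG : G.IsGood) (h : IsDecomp G A B f g) (x : G.V) :
    {y | G.cls y = G.cls x}.ncard =
      {a | A.cls a = A.cls (f x)}.ncard * {b | B.cls b = B.cls (g x)}.ncard := by
  rw [← Set.ncard_prod, ← Set.ncard_image_of_injective (f := fun z => (f z, g z)) _
      (fun z w hzw => h.inj z w (congrArg Prod.fst hzw) (congrArg Prod.snd hzw))]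
  congr 1
  ext ⟨a, b⟩
  simp only [Set.mem_image, Set.mem_ofPred_eq, Set.mem_prod, Prod.mk.injEq, h.cls_eq_iff hG]
  constructor
  · rintro ⟨z, h1, rfl, rfl⟩
    exact h1
  · rintro ⟨h1, h2⟩
    obtain ⟨z, rfl, rfl⟩ := h.surj a b (by
      rw [side_eq_of_cls_eq h1, side_eq_of_cls_eq h2, h.side_left, h.side_right])
    exact ⟨z, ⟨h1, h2⟩, rfl, rfl⟩

end

/-! ### Blow-ups -/

/-- Replace every vertex `q` by `n q` vertices with the same neighbours. -/
def blowup (Q : BipGraph.{u}) (n : Q.V → ℕ) : BipGraph.{u} where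
  V := Σ q : Q.V, Fin (n q)
  graph :=
    { Adj := fun x y => Q.graph.Adj x.1 y.1
      symm := ⟨fun _ _ h => h.symm⟩
      loopless := ⟨fun _ h => h.ne rfl⟩ }
  side x := Q.side x.1
  side_ne h := Q.side_ne h
  finite := by
    have := Q.finite
    infer_instance

theorem ncard_blowup_fiber (Q : BipGraph.{u}) (n : Q.V → ℕ) (q : Q.V) :
    {y : (Q.blowup n).V | y.1 = q}.ncard = n q := by
  have h : {y : (Q.blowup n).V | y.1 = q} =
      (fun i : Fin (n q) => (⟨q, i⟩ : Σ q : Q.V, Fin (n q))) '' Set.univ := by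
    ext ⟨p, i⟩
    constructor
    · rintro rfl
      exact ⟨i, trivial, rfl⟩
    · rintro ⟨j, -, hj⟩
      exact (congrArg Sigma.fst hj).symm
  rw [h]
  exact (Set.ncard_image_of_injective _ sigma_mk_injective).trans
    ((Set.ncard_univ _).trans (Nat.card_fin _))

/-- Adjacency sees only the pair of images in `Q` and `Q'`, so any bijection matching the fibres is
an isomorphism. Pairs from different sides have empty fibres in both graphs. -/
theorem exists_isIso_diamond_blowup {A Q Q' : BipGraph.{u}} {c : A.V → Q.V} {d : A.V → Q'.V}
    (hc : ∀ a, Q.side (c a) = A.side a) (hd : ∀ a, Q'.side (d a) = A.side a)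
    (hadj : ∀ a a', A.graph.Adj a a' ↔ Q.graph.Adj (c a) (c a') ∧ Q'.graph.Adj (d a) (d a'))
    {n : Q.V → ℕ} {n' : Q'.V → ℕ} (hn : ∀ q q', Q.side q = Q'.side q' →
      {a | c a = q ∧ d a = q'}.ncard = n q * n' q') :
    ∃ e : A.V ≃ (diamond ![Q.blowup n, Q'.blowup n']).V,
      IsIso A (diamond ![Q.blowup n, Q'.blowup n']) e := by
  have hdec := isDecomp_diamond_pair (Q.blowup n) (Q'.blowup n')
  set P := diamond ![Q.blowup n, Q'.blowup n'] with hP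
  set f : P.V → (Q.blowup n).V := fun x => DiamondVertex.coord x 0
  set g : P.V → (Q'.blowup n').V := fun x => DiamondVertex.coord x 1
  have := A.finite
  have := P.finite
  obtain ⟨e, he⟩ := exists_equiv_comp_eq (fun a => (c a, d a)) (fun x : P.V => ((f x).1, (g x).1))
    (by
      rintro ⟨q, q'⟩
      simp only [Prod.mk.injEq]
      by_cases hs : Q.side q = Q'.side q'
      · rw [hn q q' hs, ← Set.ncard_image_of_injective (f := fun z => (f z, g z)) _
          (fun z w hzw => hdec.inj z w (congrArg Prod.fst hzw) (congrArg Prod.snd hzw))]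
        have : (fun z => (f z, g z)) '' {x | (f x).1 = q ∧ (g x).1 = q'} =
            {y : (Q.blowup n).V | y.1 = q} ×ˢ {y : (Q'.blowup n').V | y.1 = q'} := by
          ext ⟨p, p'⟩
          simp only [Set.mem_image, Set.mem_ofPred_eq, Set.mem_prod, Prod.mk.injEq]
          constructor
          · rintro ⟨z, h1, rfl, rfl⟩
            exact h1
          · rintro ⟨h1, h2⟩
            obtain ⟨z, rfl, rfl⟩ := hdec.surj p p' (by
              change Q.side p.1 = Q'.side p'.1
              rw [h1, h2, hs])
            exact ⟨z, ⟨h1, h2⟩, rfl, rfl⟩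
        rw [this, Set.ncard_prod, ncard_blowup_fiber, ncard_blowup_fiber]
      · have h1 : {a | c a = q ∧ d a = q'} = ∅ := by
          ext a
          simp only [Set.mem_ofPred_eq, Set.mem_empty_iff_false, iff_false]
          rintro ⟨rfl, rfl⟩
          exact hs ((hc a).trans (hd a).symm)
        have h2 : {x | (f x).1 = q ∧ (g x).1 = q'} = ∅ := by
          ext x
          simp only [Set.mem_ofPred_eq, Set.mem_empty_iff_false, iff_false]
          rintro ⟨rfl, rfl⟩
          exact hs ((hdec.side_left x).trans (hdec.side_right x).symm)
        rw [h1, h2, Set.ncard_empty, Set.ncard_empty])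
  have he1 : ∀ a, (f (e a)).1 = c a := fun a => congrArg Prod.fst (he a)
  have he2 : ∀ a, (g (e a)).1 = d a := fun a => congrArg Prod.snd (he a)
  refine ⟨e, fun a => ?_, fun a a' => ?_⟩
  · rw [← hdec.side_left]
    change Q.side (f (e a)).1 = _
    rw [he1, hc]
  · rw [hdec.adj, hadj]
    change Q.graph.Adj (f (e a)).1 (f (e a')).1 ∧ Q'.graph.Adj (g (e a)).1 (g (e a')).1 ↔ _
    rw [he1, he1, he2, he2]

theorem IsEdge.eq_of_side_eq {G : BipGraph.{u}} (hG : G.IsEdge) {x y : G.V}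
    (h : G.side x = G.side y) : x = y := by
  obtain ⟨a, b, hab, hz⟩ := hG
  have hne := G.side_ne hab
  rcases hz x with rfl | rfl <;> rcases hz y with rfl | rfl
  · rfl
  · exact absurd h hne
  · exact absurd h.symm hne
  · rfl

/-! ### Refinement -/

section

variable {G A B C D : BipGraph.{u}} {f : G.V → A.V} {g : G.V → B.V} {c : G.V → C.V} {d : G.V → D.V}

/-- If two decompositions of the same graph are given, then the classes in a prime factor of the
first one depend on one factor of the second one only. -/
theorem IsDecomp.refinement (hG : G.IsGood) (h : IsDecomp G A B f g)
    (k : IsDecomp G C D c d) (hA : A.IsPrime) :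
    (∀ x y, C.cls (c x) = C.cls (c y) → A.cls (f x) = A.cls (f y)) ∨
      (∀ x y, D.cls (d x) = D.cls (d y) → A.cls (f x) = A.cls (f y)) := by
  classical
  have := A.finite
  have := C.quot.finite
  -- Embed `A` in `G` as the layer over an edge of `B`; composing with `c` and `d` gives every
  -- vertex of `A` a pair of classes.
  obtain ⟨b, hb, hbadj⟩ := (h.symm.isGood_left hG).exists_edge
  choose s hsf hsg using fun a => h.surj a (b (A.side a)) (hb _).symm
  have hsside : ∀ a, G.side (s a) = A.side a := fun a => by rw [← h.side_left, hsf]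
  let c' : A.V → C.quot.V := fun a => C.cls (c (s a))
  let d' : A.V → D.quot.V := fun a => D.cls (d (s a))
  have hc' : ∀ a, C.quot.side (c' a) = A.side a := fun a => (k.side_left _).trans (hsside a)
  have hd' : ∀ a, D.quot.side (d' a) = A.side a := fun a => (k.side_right _).trans (hsside a)
  have hcls : ∀ a a', A.cls a = A.cls a' ↔ c' a = c' a' ∧ d' a = d' a' := by
    intro a a'
    change _ ↔ C.cls _ = C.cls _ ∧ D.cls _ = D.cls _
    rw [← k.cls_eq_iff hG, h.cls_eq_iff hG, hsf, hsf, hsg, hsg]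
    exact ⟨fun haa => ⟨haa, by rw [side_eq_of_cls_eq haa]⟩, fun haa => haa.1⟩
  have hadj : ∀ a a', A.graph.Adj a a' ↔
      C.quot.graph.Adj (c' a) (c' a') ∧ D.quot.graph.Adj (d' a) (d' a') := by
    intro a a'
    change _ ↔ C.quot.graph.Adj (C.cls _) (C.cls _) ∧ D.quot.graph.Adj (D.cls _) (D.cls _)
    rw [quot_adj_cls, quot_adj_cls, ← k.adj, h.adj, hsf, hsf, hsg, hsg]
    exact ⟨fun haa => ⟨haa, hbadj _ _ (A.side_ne haa)⟩, fun haa => haa.1⟩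
  -- On each side the pairs fill a whole box: the mixed vertex `z` of `C ⋄ D` stays in the layer up
  -- to R.
  have hbox : ∀ a a', A.side a = A.side a' → ∃ a'', c' a'' = c' a ∧ d' a'' = d' a' := by
    intro a a' haa
    obtain ⟨z, hz1, hz2⟩ := k.surj (c (s a)) (d (s a'))
      (by rw [k.side_left, k.side_right, hsside, hsside, haa])
    have hg : g (s a) = g (s a') := by rw [hsg, hsg, haa]
    have hz := h.cls_right_eq_of_mix hG k hg hz1 hz2
    have hzs : A.side (f z) = A.side a := by
      rw [h.side_left, ← hsside a, ← k.side_left, hz1, k.side_left]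
    have h1 : G.cls (s (f z)) = G.cls z := by
      rw [h.cls_eq_iff hG, hsf, hz, hsg, hsg, hzs]
      exact ⟨rfl, rfl⟩
    rw [k.cls_eq_iff hG, hz1, hz2] at h1
    exact ⟨f z, h1⟩
  -- A class of `G` has size `|A-class| * |B-class|` and also `|C-class| * |D-class|`. On one side
  -- of the layer the `B`-class is fixed, so the sizes of the `A`-classes have rank one on the box;
  -- outside it they are 0.
  have hfac : ∀ t : Bool, ∃ (n : C.quot.V → ℕ) (n' : D.quot.V → ℕ), ∀ q q',
      {a | A.side a = t ∧ c' a = q ∧ d' a = q'}.ncard = n q * n' q' := by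
    intro t
    have hK : 0 < {z | B.cls z = B.cls (b t)}.ncard := by
      have := B.finite
      exact (Set.ncard_pos (Set.toFinite _)).2 ⟨_, rfl⟩
    refine Nat.exists_eq_mul_of_mul_eq_mul hK
      (κ := fun q => if ∃ a, A.side a = t ∧ c' a = q then {z | C.cls z = q}.ncard else 0)
      (μ := fun q => if ∃ a, A.side a = t ∧ d' a = q then {z | D.cls z = q}.ncard else 0) ?_
    intro q q'
    by_cases hq : (∃ a, A.side a = t ∧ c' a = q) ∧ ∃ a, A.side a = t ∧ d' a = q'
    · rw [if_pos hq.1, if_pos hq.2]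
      obtain ⟨⟨a, ha, rfl⟩, a', ha', rfl⟩ := hq
      obtain ⟨a0, h1, h2⟩ := hbox a a' (ha.trans ha'.symm)
      have h0 : A.side a0 = t := by rw [← hc', h1, hc', ha]
      have h3 := h.ncard_cls hG (s a0)
      rw [k.ncard_cls hG (s a0), hsf, hsg, h0] at h3
      rw [← h1, ← h2, mul_comm]
      refine Eq.trans ?_ h3.symm
      congr 2
      ext a1
      simp only [Set.mem_ofPred_eq, hcls]
      refine ⟨fun h4 => h4.2, fun h4 => ⟨?_, h4⟩⟩
      rw [← hc', h4.1, hc', h0]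
    · have h1 : {a | A.side a = t ∧ c' a = q ∧ d' a = q'} = ∅ := by
        ext a
        simp only [Set.mem_ofPred_eq, Set.mem_empty_iff_false, iff_false]
        rintro ⟨h1, h2, h3⟩
        exact hq ⟨⟨a, h1, h2⟩, a, h1, h3⟩
      rw [h1, Set.ncard_empty, mul_zero]
      rcases not_and_or.1 hq with h2 | h2
      · rw [if_neg h2, zero_mul]
      · rw [if_neg h2, mul_zero]
  choose n n' hn using hfac
  have hn' : ∀ q q', C.quot.side q = D.quot.side q' → {a | c' a = q ∧ d' a = q'}.ncard =
      n (C.quot.side q) q * n' (D.quot.side q') q' := by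
    intro q q' hqq
    rw [← hqq, ← hn]
    congr 1
    ext a
    simp only [Set.mem_ofPred_eq]
    refine ⟨fun h1 => ⟨?_, h1⟩, fun h1 => h1.2⟩
    rw [← h1.1, hc']
  have hpos : ∀ a, 0 < n (C.quot.side (c' a)) (c' a) ∧ 0 < n' (D.quot.side (d' a)) (d' a) := by
    intro a
    have h1 : 0 < {a1 | c' a1 = c' a ∧ d' a1 = d' a}.ncard :=
      (Set.ncard_pos (Set.toFinite _)).2 ⟨a, rfl, rfl⟩
    rw [hn' _ _ ((hc' a).trans (hd' a).symm)] at h1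
    exact ⟨Nat.pos_of_mul_pos_right h1, Nat.pos_of_mul_pos_left h1⟩
  obtain ⟨e, he⟩ := exists_isIso_diamond_blowup hc' hd' hadj
    (n := fun q => n (C.quot.side q) q) (n' := fun q => n' (D.quot.side q) q) hn'
  have hside : ∀ x y, A.side (f x) = A.side (f y) → g (s (f x)) = g (s (f y)) := by
    intro x y hxy
    rw [hsg, hsg, hxy]
  -- A blow-up that is an edge has one vertex per side, so its coordinate is determined by the side.
  -- The other coordinate is determined by the class in the corresponding factor, by projection to
  -- the layer.
  rcases hA _ _ e he with h1 | h1
  · right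
    intro x y hxy
    have hs : A.side (f x) = A.side (f y) := by
      rw [h.side_left, h.side_left, ← k.side_right, ← k.side_right, side_eq_of_cls_eq hxy]
    rw [hcls]
    refine ⟨?_, h.cls_left_eq_of_layer hG k.symm hxy (hsf _) (hsf _) (hside x y hs)⟩
    exact congrArg Sigma.fst (h1.eq_of_side_eq (x := ⟨c' (f x), ⟨0, (hpos _).1⟩⟩)
      (y := ⟨c' (f y), ⟨0, (hpos _).1⟩⟩) ((hc' _).trans (hs.trans (hc' _).symm)))
  · left
    intro x y hxy
    have hs : A.side (f x) = A.side (f y) := by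
      rw [h.side_left, h.side_left, ← k.side_left, ← k.side_left, side_eq_of_cls_eq hxy]
    rw [hcls]
    refine ⟨h.cls_left_eq_of_layer hG k hxy (hsf _) (hsf _) (hside x y hs), ?_⟩
    exact congrArg Sigma.fst (h1.eq_of_side_eq (x := ⟨d' (f x), ⟨0, (hpos _).2⟩⟩)
      (y := ⟨d' (f y), ⟨0, (hpos _).2⟩⟩) ((hd' _).trans (hs.trans (hd' _).symm)))

end

end BipGraph

namespace BipGraph

/-! ### Automorphisms of diamond products -/

/-- Up to classes, a coordinate of the image of a vertex under an automorphism of a diamond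
product is determined by one coordinate of the vertex, provided that the factor of the image
coordinate is prime. -/
theorem IsIso.coord_diamond {M : Type} [Finite M] {Ks : M → BipGraph.{u}}
    (hKs : ∀ m, (Ks m).IsGood) {ψ : (diamond Ks).V ≃ (diamond Ks).V}
    (hψ : IsIso (diamond Ks) (diamond Ks) ψ) {m : M} (hm : (Ks m).IsPrime) :
    (∃ n, ∀ x y, (Ks n).cls (DiamondVertex.coord x n) = (Ks n).cls (DiamondVertex.coord y n) →
      (Ks m).cls (DiamondVertex.coord (ψ x) m) = (Ks m).cls (DiamondVertex.coord (ψ y) m)) ∨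
    ∀ x y, (diamond Ks).side x = (diamond Ks).side y →
      (Ks m).cls (DiamondVertex.coord (ψ x) m) = (Ks m).cls (DiamondVertex.coord (ψ y) m) := by
  have hG := isGood_diamond Ks hKs
  by_cases h : ∃ n, ∀ x y,
      (Ks n).cls (DiamondVertex.coord x n) = (Ks n).cls (DiamondVertex.coord y n) →
      (Ks m).cls (DiamondVertex.coord (ψ x) m) = (Ks m).cls (DiamondVertex.coord (ψ y) m)
  · exact Or.inl h
  · right
    -- If no single coordinate suffices, refinement against each factor `n` shows that changing only
    -- coordinate `n` has no effect.
    refine diamond_induction Ks _ (fun x => rfl) (fun x y z h1 h2 => h1.trans h2) ?_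
    intro n x y hxy hn
    rcases ((isDecomp_diamond Ks m).comp_iso hψ).refinement hG (isDecomp_diamond Ks n) hm with
      h1 | h1
    · exact absurd ⟨n, h1⟩ h
    · exact h1 x y (congrArg _ (DiamondVertex.ext hxy (funext fun i => hn i i.2)))

theorem cls_diamond_eq_iff {M : Type} [Finite M] {Ks : M → BipGraph.{u}}
    (hKs : ∀ m, (Ks m).IsGood) {x y : (diamond Ks).V} :
    (diamond Ks).cls x = (diamond Ks).cls y ↔ (diamond Ks).side x = (diamond Ks).side y ∧
      ∀ m, (Ks m).cls (DiamondVertex.coord x m) = (Ks m).cls (DiamondVertex.coord y m) := by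
  constructor
  · intro h
    exact ⟨side_eq_of_cls_eq h, fun m =>
      (((isDecomp_diamond Ks m).cls_eq_iff (isGood_diamond Ks hKs)).1 h).1⟩
  · rintro ⟨h1, h2⟩
    refine BipGraph.cls_eq_iff.2 ⟨h1, ?_⟩
    ext z
    change (_ ≠ _ ∧ _) ↔ (_ ≠ _ ∧ _)
    change DiamondVertex.side x = DiamondVertex.side y at h1
    rw [h1]
    exact and_congr_right fun _ => forall_congr' fun m => adj_iff_of_cls_eq (h2 m)

/-! ### Powers of a diamond product and the effect of the constants -/

section

variable {H : BipGraph.{u}} {ι : Type} [Finite ι] {Hs : ι → BipGraph.{u}}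
  {e : H.V ≃ (diamond Hs).V}

/-- The power of a diamond product as a diamond product. -/
def powerEquiv (he : IsIso H (diamond Hs) e) (ℓ : ℕ) :
    (H.power ℓ).V ≃ (diamond fun m : Fin ℓ × ι => Hs m.2).V where
  toFun x := ⟨DiamondVertex.side x, fun m => DiamondVertex.coord (e (DiamondVertex.coord x m.1)) m.2,
    fun m => (DiamondVertex.side_coord _ m.2).trans
      ((he.1 _).trans (DiamondVertex.side_coord x m.1))⟩
  invFun y := ⟨DiamondVertex.side y, fun i => e.symm ⟨DiamondVertex.side y,
      fun j => DiamondVertex.coord y (i, j), fun j => DiamondVertex.side_coord y (i, j)⟩,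
    fun i => he.symm.1 _⟩
  left_inv x := by
    refine DiamondVertex.ext rfl (funext fun i => ?_)
    refine (Equiv.symm_apply_eq _).2 (DiamondVertex.ext ?_ rfl)
    exact ((he.1 _).trans (DiamondVertex.side_coord x i)).symm
  right_inv y := by
    refine DiamondVertex.ext rfl (funext fun m => ?_)
    exact congrArg (fun z => DiamondVertex.coord z m.2) (e.apply_symm_apply _)

theorem powerEquiv_isIso (he : IsIso H (diamond Hs) e) (ℓ : ℕ) :
    IsIso (H.power ℓ) (diamond fun m : Fin ℓ × ι => Hs m.2) (powerEquiv he ℓ) := by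
  refine ⟨fun x => rfl, fun x y => and_congr_right fun hxy => ?_⟩
  constructor
  · intro h i
    rw [← he.2]
    refine ⟨?_, fun j => h (i, j)⟩
    have h1 := (he.1 (DiamondVertex.coord x i)).trans (DiamondVertex.side_coord x i)
    have h2 := (he.1 (DiamondVertex.coord y i)).trans (DiamondVertex.side_coord y i)
    intro h3
    exact hxy (h1.symm.trans (h3.trans h2))
  · intro h m
    exact ((he.2 _ _).2 (h m.1)).2 m.2

/-- The class of the `j`-th coordinate of the `i`-th coordinate of a vertex of a power. -/
def coordCls (e : H.V ≃ (diamond Hs).V) {ℓ : ℕ} (x : (H.power ℓ).V) (i : Fin ℓ) (j : ι) :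
    (Hs j).quot.V :=
  (Hs j).cls (DiamondVertex.coord (e (DiamondVertex.coord x i)) j)

/-- The constant tuples. -/
def const (H : BipGraph.{u}) (ℓ : ℕ) (a : H.V) : (H.power ℓ).V :=
  ⟨H.side a, fun _ => a, fun _ => rfl⟩

theorem isGood_factor (hH : H.IsGood) (he : IsIso H (diamond Hs) e) (j : ι) : (Hs j).IsGood :=
  ((isDecomp_diamond Hs j).comp_iso he).isGood_left hH

theorem cls_power_eq_iff (hH : H.IsGood) (he : IsIso H (diamond Hs) e) {ℓ : ℕ}
    {x y : (H.power ℓ).V} : (H.power ℓ).cls x = (H.power ℓ).cls y ↔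
      (H.power ℓ).side x = (H.power ℓ).side y ∧ ∀ i j, coordCls e x i j = coordCls e y i j := by
  rw [← (powerEquiv_isIso he ℓ).cls_eq_iff, cls_diamond_eq_iff
    (Ks := fun m : Fin ℓ × ι => Hs m.2) fun m => isGood_factor hH he m.2]
  exact and_congr_right fun _ => Prod.forall

theorem exists_coord_eq_and_eq (z : (diamond Hs).V) (j : ι) (a : (Hs j).V)
    (ha : (Hs j).side a = (diamond Hs).side z) : ∃ w : (diamond Hs).V,
      DiamondVertex.coord w j = a ∧
        ∀ n, n ≠ j → DiamondVertex.coord w n = DiamondVertex.coord z n := by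
  classical
  refine ⟨⟨DiamondVertex.side z, Function.update (DiamondVertex.coord z) j a, fun n => ?_⟩,
    Function.update_self j a (DiamondVertex.coord z),
    fun n hn => Function.update_of_ne hn a (DiamondVertex.coord z)⟩
  by_cases hn : n = j
  · subst hn
    rw [Function.update_self]
    exact ha
  · rw [Function.update_of_ne hn]
    exact DiamondVertex.side_coord z n

/-- If the image coordinate `(i, j)` depends only on the coordinate `(i', j)` of `x`, then `x` may
be replaced by the constant tuple of its `i'`-th entry, whose coordinate classes are fixed.
Dependence on another factor `j'` is impossible: two constants that differ only in factor `j` would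
get equal images there. -/
theorem exists_perm_of_cls_const (hH : H.IsGood) (he : IsIso H (diamond Hs) e)
    (hprime : ∀ j, (Hs j).IsPrime) {ℓ : ℕ} {ψ : Equiv.Perm (H.power ℓ).V}
    (hψ : IsIso (H.power ℓ) (H.power ℓ) ψ)
    (hconst : ∀ a i j, coordCls e (ψ (const H ℓ a)) i j = coordCls e (const H ℓ a) i j) :
    ∃ π : ι → Equiv.Perm (Fin ℓ), ∀ x i j, coordCls e (ψ x) i j = coordCls e x (π j i) j := by
  classical
  have hHs := isGood_factor hH he
  obtain ⟨base, hbase⟩ : ∃ base : Bool → (diamond Hs).V, ∀ s, (diamond Hs).side (base s) = s := by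
    obtain ⟨b, hb, -⟩ := (isGood_diamond Hs hHs).exists_edge
    exact ⟨b, hb⟩
  have hside : ∀ (x : (H.power ℓ).V) i j,
      (Hs j).side (DiamondVertex.coord (e (DiamondVertex.coord x i)) j) = (H.power ℓ).side x :=
    fun x i j => (DiamondVertex.side_coord _ j).trans ((he.1 _).trans (DiamondVertex.side_coord x i))
  have hpair : ∀ j (a a' : (Hs j).V), (Hs j).side a = (Hs j).side a' → ∃ h h' : H.V,
      H.side h = H.side h' ∧ DiamondVertex.coord (e h) j = a ∧ DiamondVertex.coord (e h') j = a' ∧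
      ∀ n, n ≠ j → DiamondVertex.coord (e h) n = DiamondVertex.coord (e h') n := by
    intro j a a' haa
    obtain ⟨w, hw, hwn⟩ := exists_coord_eq_and_eq (base ((Hs j).side a)) j a (hbase _).symm
    obtain ⟨w', hw', hwn'⟩ := exists_coord_eq_and_eq (base ((Hs j).side a)) j a'
      (haa.symm.trans (hbase _).symm)
    refine ⟨e.symm w, e.symm w', ?_, ?_, ?_, fun n hn => ?_⟩
    · rw [he.symm.1, he.symm.1]
      refine (DiamondVertex.side_coord w j).symm.trans (Eq.trans ?_ (DiamondVertex.side_coord w' j))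
      rw [hw, hw', haa]
    · rw [e.apply_symm_apply, hw]
    · rw [e.apply_symm_apply, hw']
    · rw [e.apply_symm_apply, e.apply_symm_apply, hwn n hn, hwn' n hn]
  let E := powerEquiv he ℓ
  have hE := powerEquiv_isIso he ℓ
  have hψ' : IsIso _ _ ((E.symm.trans ψ).trans E) := (hE.symm.trans hψ).trans hE
  have hEψ : ∀ x i j, (Hs j).cls (DiamondVertex.coord (((E.symm.trans ψ).trans E) (E x)) (i, j)) =
      coordCls e (ψ x) i j := by
    intro x i j
    simp only [Equiv.trans_apply, Equiv.symm_apply_apply]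
    rfl
  have key : ∀ j, (∃ a a', (Hs j).side a = (Hs j).side a' ∧ (Hs j).cls a ≠ (Hs j).cls a') →
      ∀ i, ∃ i', ∀ x, coordCls e (ψ x) i j = coordCls e x i' j := by
    rintro j ⟨a, a', haa, hne⟩ i
    obtain ⟨h, h', hs, rfl, rfl, hn⟩ := hpair j a a' haa
    rcases hψ'.coord_diamond (m := (i, j)) (fun m => hHs m.2) (hprime j) with ⟨⟨i', j'⟩, h1⟩ | h1
    · have h2 : ∀ x y, coordCls e x i' j' = coordCls e y i' j' →
          coordCls e (ψ x) i j = coordCls e (ψ y) i j := by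
        intro x y hxy
        have := h1 (E x) (E y) hxy
        rwa [hEψ, hEψ] at this
      by_cases hj : j' = j
      · subst hj
        refine ⟨i', fun x => ?_⟩
        have h3 := h2 x (const H ℓ (DiamondVertex.coord x i')) rfl
        rw [hconst] at h3
        exact h3
      · have h3 := h2 (const H ℓ h) (const H ℓ h') (congrArg (Hs j').cls (hn j' hj))
        rw [hconst, hconst] at h3
        exact absurd h3 hne
    · have h2 := h1 (E (const H ℓ h)) (E (const H ℓ h')) hs
      rw [hEψ, hEψ, hconst, hconst] at h2
      exact absurd h2 hne
  have hperm : ∀ j, ∃ π : Equiv.Perm (Fin ℓ), ∀ x i,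
      coordCls e (ψ x) i j = coordCls e x (π i) j := by
    intro j
    by_cases hj : ∃ a a', (Hs j).side a = (Hs j).side a' ∧ (Hs j).cls a ≠ (Hs j).cls a'
    · choose π hπ using key j hj
      obtain ⟨a, a', haa, hne⟩ := hj
      obtain ⟨h, h', hs, rfl, rfl, -⟩ := hpair j a a' haa
      have hinj : Function.Injective π := by
        intro i1 i2 hi
        by_contra hii
        -- This tuple has different classes at `(i1, j)` and `(i2, j)`, whereas `π i1 = π i2` would
        -- make them equal for every image under `ψ`.
        let y : (H.power ℓ).V := ⟨H.side h, fun i => if i = i1 then h else h', fun i => by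
          split_ifs
          · rfl
          · exact hs.symm⟩
        obtain ⟨x, hx⟩ := ψ.surjective y
        have h1 := hπ i1 x
        have h2 := hπ i2 x
        rw [hi, ← h2, hx] at h1
        have e1 : DiamondVertex.coord y i1 = h := if_pos rfl
        have e2 : DiamondVertex.coord y i2 = h' := if_neg (Ne.symm hii)
        rw [coordCls, coordCls, e1, e2] at h1
        exact hne h1
      exact ⟨Equiv.ofBijective π (Finite.injective_iff_bijective.1 hinj), fun x i => hπ i x⟩
    -- A factor with one class per side carries no information, so any permutation works.
    · refine ⟨1, fun x i => ?_⟩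
      by_contra hne
      exact hj ⟨_, _, (hside (ψ x) i j).trans ((hψ.1 x).trans (hside x _ j).symm), hne⟩
  choose π hπ using hperm
  exact ⟨π, fun x i j => hπ j x i⟩

end

end BipGraph

namespace BipGraph

/-! ### Prime factorizations -/

/-- If `A` had as many vertices as `G`, the surjection `f` would be injective, leaving `B` one
vertex per side. -/
theorem IsDecomp.card_lt {G A B : BipGraph.{u}} {f : G.V → A.V} {g : G.V → B.V} (hG : G.IsGood)
    (h : IsDecomp G A B f g) (hB : ¬ B.IsEdge) : Nat.card A.V < Nat.card G.V := by
  have := G.finite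
  have := A.finite
  have hsurj : Function.Surjective f := h.exists_left hG
  refine lt_of_le_of_ne (Nat.card_le_card_of_surjective f hsurj) fun heq => ?_
  have hinj : Function.Injective f := (hsurj.bijective_of_nat_card_le heq.ge).1
  obtain ⟨b, hb, hbadj⟩ := (h.symm.isGood_left hG).exists_edge
  refine hB ⟨b false, b true, hbadj _ _ (by simp), ?_⟩
  have key : ∀ z, z = b (B.side z) := by
    intro z
    obtain ⟨a, ha⟩ := (h.isGood_left hG).exists_side (B.side z)
    obtain ⟨x, hx, rfl⟩ := h.surj a z ha
    obtain ⟨y, hy, hy'⟩ := h.surj a (b (B.side (g x))) (by rw [hb, ha])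
    rw [← hy', hinj (hx.trans hy.symm)]
  intro z
  cases hz : B.side z
  · exact Or.inl (hz ▸ key z)
  · exact Or.inr (hz ▸ key z)

theorem IsDecomp.exists_isIso_sum {G A B : BipGraph.{u}} {f : G.V → A.V} {g : G.V → B.V}
    (h : IsDecomp G A B f g) {ι κ : Type} [Finite ι] [Finite κ] {As : ι → BipGraph.{u}}
    {Bs : κ → BipGraph.{u}} {e : A.V ≃ (diamond As).V} {e' : B.V ≃ (diamond Bs).V}
    (he : IsIso A (diamond As) e) (he' : IsIso B (diamond Bs) e') :
    ∃ E : G.V ≃ (diamond (Sum.elim As Bs)).V, IsIso G (diamond (Sum.elim As Bs)) E := by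
  have hs : ∀ x, DiamondVertex.side (e (f x)) = G.side x := fun x =>
    (he.1 _).trans (h.side_left x)
  have hs' : ∀ x, DiamondVertex.side (e' (g x)) = G.side x := fun x =>
    (he'.1 _).trans (h.side_right x)
  let F : G.V → (diamond (Sum.elim As Bs)).V := fun x =>
    ⟨G.side x, fun n => Sum.rec (motive := fun n => (Sum.elim As Bs n).V)
      (DiamondVertex.coord (e (f x))) (DiamondVertex.coord (e' (g x))) n, by
      rintro (i | i)
      · exact (DiamondVertex.side_coord (e (f x)) i).trans (hs x)
      · exact (DiamondVertex.side_coord (e' (g x)) i).trans (hs' x)⟩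
  have hF : Function.Bijective F := by
    constructor
    · intro x y hxy
      have h0 : G.side x = G.side y := congrArg DiamondVertex.side hxy
      have h1 := congrArg DiamondVertex.coord hxy
      refine h.inj x y (e.injective (DiamondVertex.ext ?_ ?_))
        (e'.injective (DiamondVertex.ext ?_ ?_))
      · rw [hs, hs, h0]
      · exact funext fun i => congrFun h1 (Sum.inl i)
      · rw [hs', hs', h0]
      · exact funext fun i => congrFun h1 (Sum.inr i)
    · rintro ⟨s, c, hc⟩
      let w : (diamond As).V := ⟨s, fun i => c (Sum.inl i), fun i => hc (Sum.inl i)⟩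
      let w' : (diamond Bs).V := ⟨s, fun i => c (Sum.inr i), fun i => hc (Sum.inr i)⟩
      obtain ⟨x, h1, h2⟩ := h.surj (e.symm w) (e'.symm w')
        ((he.symm.1 w).trans (he'.symm.1 w').symm)
      rw [Equiv.eq_symm_apply] at h1 h2
      refine ⟨x, DiamondVertex.ext ?_ ?_⟩
      · change G.side x = s
        rw [← hs, h1]
      · funext n
        rcases n with i | i
        · exact congrArg (fun z => DiamondVertex.coord z i) h1
        · exact congrArg (fun z => DiamondVertex.coord z i) h2
  refine ⟨Equiv.ofBijective F hF, fun x => rfl, fun x y => ?_⟩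
  rw [h.adj, ← he.2, ← he'.2]
  constructor
  · rintro ⟨h1, h2⟩
    refine ⟨⟨?_, fun i => h2 (Sum.inl i)⟩, ?_, fun i => h2 (Sum.inr i)⟩
    · rw [hs, hs]
      exact h1
    · rw [hs', hs']
      exact h1
  · rintro ⟨⟨h1, h2⟩, h3, h4⟩
    refine ⟨?_, ?_⟩
    · rw [hs, hs] at h1
      exact h1
    · rintro (i | i)
      · exact h2 i
      · exact h4 i

theorem exists_isIso_diamond_unit (G : BipGraph.{u}) :
    ∃ e : G.V ≃ (diamond fun _ : Unit => G).V, IsIso G (diamond fun _ : Unit => G) e :=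
  ⟨{ toFun := fun x => ⟨G.side x, fun _ => x, fun _ => rfl⟩
     invFun := fun y => DiamondVertex.coord y ()
     left_inv := fun _ => rfl
     right_inv := fun y => DiamondVertex.ext (DiamondVertex.side_coord y ()) rfl },
    fun _ => rfl, fun _ _ => ⟨fun h => h.2 (), fun h => ⟨G.side_ne h, fun _ => h⟩⟩⟩

/-- Existence of prime factorizations. -/
theorem IsGood.exists_prime_factorization {G : BipGraph.{u}} (hG : G.IsGood) :
    ∃ (ι : Type) (_ : Finite ι) (Hs : ι → BipGraph.{u}) (e : G.V ≃ (diamond Hs).V),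
      IsIso G (diamond Hs) e ∧ ∀ j, (Hs j).IsPrime := by
  induction hn : Nat.card G.V using Nat.strong_induction_on generalizing G with
  | _ n ih =>
    by_cases hp : G.IsPrime
    · obtain ⟨e, he⟩ := exists_isIso_diamond_unit G
      exact ⟨Unit, inferInstance, fun _ => G, e, he, fun _ => hp⟩
    · simp only [IsPrime, not_forall, not_or] at hp
      obtain ⟨A, B, e, he, hA, hB⟩ := hp
      have h := (isDecomp_diamond_pair A B).comp_iso he
      subst hn
      obtain ⟨ι, _, As, e1, he1, hAs⟩ := ih _ (h.card_lt hG hB) (h.isGood_left hG) rfl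
      obtain ⟨κ, _, Bs, e2, he2, hBs⟩ := ih _ (h.symm.card_lt hG hA) (h.symm.isGood_left hG) rfl
      obtain ⟨E, hE⟩ := h.exists_isIso_sum he1 he2
      refine ⟨ι ⊕ κ, inferInstance, Sum.elim As Bs, E, hE, ?_⟩
      rintro (j | j)
      · exact hAs j
      · exact hBs j

/-! ### Powers with constants -/

theorem power_eq_of_side_eq {H : BipGraph.{u}} [Subsingleton H.V] {ℓ : ℕ} {x y : (H.power ℓ).V}
    (h : (H.power ℓ).side x = (H.power ℓ).side y) : x = y :=
  DiamondVertex.ext h (funext fun _ => Subsingleton.elim _ _)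

/-- Automorphisms of powers of `H` that fix the classes of all constant tuples permute the prime
factors of `H`. -/
theorem exists_perm_of_quot_aut {H : BipGraph.{u}} (hH : H.IsGood) {ι : Type} [Finite ι]
    {Hs : ι → BipGraph.{u}} {e : H.V ≃ (diamond Hs).V} (he : IsIso H (diamond Hs) e)
    (hprime : ∀ j, (Hs j).IsPrime) {ℓ : ℕ} {ψ : Equiv.Perm (H.power ℓ).V}
    (hψ : IsIso (H.power ℓ) (H.power ℓ) ψ)
    (hconst : ∀ a, ∃ z ∈ (H.withConstants.power ℓ).rel a,
      (H.power ℓ).cls z = (H.power ℓ).cls (ψ (const H ℓ a))) :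
    ∃ π : ι → Equiv.Perm (Fin ℓ), ∀ x i j, coordCls e (ψ x) i j = coordCls e x (π j i) j := by
  refine exists_perm_of_cls_const hH he hprime hψ fun a i j => ?_
  -- The coordinates of `z` are those of the constant tuple. Its recorded side could differ only for
  -- `ℓ = 0`, where there is nothing to compare.
  obtain ⟨z, hz, hzψ⟩ := hconst a
  rw [← ((cls_power_eq_iff hH he).1 hzψ).2 i j]
  have hzi : DiamondVertex.coord z i = a := hz i
  exact congrArg (fun h => (Hs j).cls (DiamondVertex.coord (e h) j)) hzi

theorem const_mem_rel (H : BipGraph.{u}) (ℓ : ℕ) (a : H.V) :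
    const H ℓ a ∈ (H.withConstants.power ℓ).rel a :=
  fun _ => rfl

/-- Powers of `ψ` permute coordinates by powers of the `π j`, so `ψ ^ ℓ!` fixes all classes. Since
`ℓ!` is coprime to the order `p`, `ψ` is itself a power of `ψ ^ ℓ!`. -/
theorem cls_apply_eq_of_orderOf_eq {H : BipGraph.{u}} (hH : H.IsGood) {ℓ : ℕ}
    {ψ : Equiv.Perm (H.power ℓ).V} (hψ : IsIso (H.power ℓ) (H.power ℓ) ψ)
    (hconst : ∀ a, ∃ z ∈ (H.withConstants.power ℓ).rel a,
      (H.power ℓ).cls z = (H.power ℓ).cls (ψ (const H ℓ a)))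
    {p : ℕ} (hp : p.Prime) (hℓ : ℓ < p) (horder : orderOf ψ = p) (x : (H.power ℓ).V) :
    (H.power ℓ).cls (ψ x) = (H.power ℓ).cls x := by
  obtain ⟨ι, _, Hs, e, he, hprime⟩ := hH.exists_prime_factorization
  obtain ⟨π, hπ⟩ := exists_perm_of_quot_aut hH he hprime hψ hconst
  have hpow : ∀ (n : ℕ) (x : (H.power ℓ).V), (H.power ℓ).side ((ψ ^ n) x) = (H.power ℓ).side x ∧
      ∀ i j, coordCls e ((ψ ^ n) x) i j = coordCls e x ((π j ^ n) i) j := by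
    intro n
    induction n with
    | zero => exact fun x => ⟨rfl, fun i j => rfl⟩
    | succ n ih =>
      intro x
      rw [pow_succ', Equiv.Perm.mul_apply]
      refine ⟨(hψ.1 _).trans (ih x).1, fun i j => ?_⟩
      rw [hπ, (ih x).2, pow_succ, Equiv.Perm.mul_apply]
  have hlocal : ∀ x, (H.power ℓ).cls ((ψ ^ ℓ.factorial) x) = (H.power ℓ).cls x := by
    intro x
    refine (cls_power_eq_iff hH he).2 ⟨(hpow _ x).1, fun i j => ?_⟩
    have h1 : π j ^ ℓ.factorial = 1 := by
      have h2 := pow_card_eq_one (x := π j)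
      rwa [Fintype.card_perm, Fintype.card_fin] at h2
    rw [(hpow _ x).2, h1, Equiv.Perm.one_apply]
  have hlocal' : ∀ (m : ℕ) x,
      (H.power ℓ).cls (((ψ ^ ℓ.factorial) ^ m) x) = (H.power ℓ).cls x := by
    intro m
    induction m with
    | zero => exact fun x => rfl
    | succ m ih =>
      intro x
      rw [pow_succ, Equiv.Perm.mul_apply, ih, hlocal]
  have hco : Nat.Coprime ℓ.factorial (orderOf ψ) := by
    rw [horder, Nat.coprime_comm, hp.coprime_iff_not_dvd, hp.dvd_factorial]
    exact not_le.2 hℓ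
  obtain ⟨m, hm⟩ := exists_pow_eq_self_of_coprime hco
  have h := hlocal' m x
  rwa [hm] at h

end BipGraph

open BipGraph in
theorem mainTheorem7 (H : BipGraph.{u}) (hconn : H.graph.Connected) :
    (∀ (k : ℕ) (Hs : Fin k → BipGraph.{u}) (e : H.V ≃ (BipGraph.diamond Hs).V),
      BipGraph.IsIso H (BipGraph.diamond Hs) e →
      (∀ j, (Hs j).IsPrime) →
      ∀ (ℓ : ℕ) (φ : Equiv.Perm (H.withConstants.power ℓ).quot.V),
        (H.withConstants.power ℓ).quot.IsAut φ →
        (∃ ψ : Equiv.Perm (H.power ℓ).V, BipGraph.IsIso (H.power ℓ) (H.power ℓ) ψ ∧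
          ∀ x, φ ((H.power ℓ).cls x) = (H.power ℓ).cls (ψ x)) →
        ∃ π : Fin k → Equiv.Perm (Fin ℓ),
          ∀ x y : (H.withConstants.power ℓ).V,
            φ ((H.power ℓ).cls x) = (H.power ℓ).cls y ↔
              (H.power ℓ).side y = (H.power ℓ).side x ∧
                ∀ i j, H.factorCoord Hs e y i j = H.factorCoord Hs e x (π j i) j) ∧
    (∀ (p ℓ : ℕ), p.Prime → ℓ < p →
      ∀ ψ : Equiv.Perm (H.withConstants.power ℓ).V,
        (H.withConstants.power ℓ).IsAut ψ → orderOf ψ = p →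
          (H.withConstants.power ℓ).IsLocal ψ) := by
  -- A single vertex is isolated, so the metric argument does not apply; but then every power has at
  -- most one vertex per side.
  rcases subsingleton_or_nontrivial H.V with hsub | hnon
  · constructor
    · rintro k Hs e he - ℓ φ - ⟨ψ, hψ, hφψ⟩
      refine ⟨fun _ => 1, fun x y => ?_⟩
      refine Iff.trans (Eq.congr_left (hφψ x)) ?_
      constructor
      · intro h
        refine ⟨(side_eq_of_cls_eq h).symm.trans (hψ.1 x), fun i j => ?_⟩
        exact congrArg (fun z => (Hs j).cls (DiamondVertex.coord (e z) j)) (Subsingleton.elim _ _)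
      · rintro ⟨h, -⟩
        exact congrArg (H.power ℓ).cls (power_eq_of_side_eq ((hψ.1 x).trans h.symm))
    · intro p ℓ _ _ ψ hψ _ x
      exact congrArg (H.power ℓ).cls (power_eq_of_side_eq (H := H) (hψ.1.1 x))
  have hH := isGood_of_connected hconn
  constructor
  · rintro k Hs e he hprime ℓ φ hφ ⟨ψ, hψ, hφψ⟩
    obtain ⟨π, hπ⟩ := exists_perm_of_quot_aut hH he hprime hψ fun a => by
      have h := (hφ.2 a ((H.power ℓ).cls (const H ℓ a))).2 ⟨_, const_mem_rel H ℓ a, rfl⟩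
      rw [hφψ] at h
      exact h
    refine ⟨π, fun x y => ?_⟩
    refine (Eq.congr_left (hφψ x)).trans ((cls_power_eq_iff hH he).trans (and_congr ?_ ?_))
    · exact (Eq.congr_left (hψ.1 x)).trans eq_comm
    · exact forall_congr' fun i => forall_congr' fun j => (Eq.congr_left (hπ x i j)).trans eq_comm
  · intro p ℓ hp hℓ ψ hψ horder
    exact cls_apply_eq_of_orderOf_eq hH hψ.1 (fun a =>
      ⟨_, (hψ.2 a (const H ℓ a)).2 (const_mem_rel H ℓ a), rfl⟩) hp hℓ horder
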